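/- Let $N\ge 1$ and let $H:[0,1]\to\mathbb C^{N\times N}$ be Hermitian-matrix valued and three times differentiable, with $\|\dot H\|,\|\ddot H\|,\|\dddot H\|$ denoting the (finite) maxima over $s\in[0,1]$ of the operator norms of its first three derivatives. Let $|\nu(s)\rangle$, $\nu\in\{0,\dots,N-1\}$, be a differentiable orthonormal basis of instantaneous eigenvectors, $H(s)|\nu(s)\rangle=E_\nu(s)|\nu(s)\rangle$. Call two levels $\mu,\nu$ degenerate if $E_\mu\equiv E_\nu$ on $[0,1]$, and let the eigenvectors be chosen such that $\langle\dot\mu(s)|\nu(s)\rangle=0$ for all $s$ whenever $\mu,\nu$ are degenerate (in particular for $\mu=\nu$). Suppose that the eigenvalue gap between any two non-degenerate levels is bounded below on $[0,1]$ by $\gamma_{\min}>0$ (for instance, $\gamma_{\min}$ is the minimum gap), and let $|G(s)\rangle$ be one of the eigenvectors of the basis which is non-degenerate: $E_\nu(s)\ne E_G(s)$ for all $\nu\neq G$ and $s\in[0,1]$. For $T>0$ let $U(s,0)$ be the time-evolution operator, i.e. $\frac{d}{ds}U(s,0)=-iT\,H(s)U(s,0)$, $U(0,0)=1$. Put $\gamma_{G,\nu}(s)=E_G(s)-E_\nu(s)$,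 $\phi_\nu=T\int_0^1E_\nu(\xi)\,d\xi$, $P_G(1)=|G(1)\rangle\langle G(1)|$. Then, for every $T>0$, $$\left\|(1-P_G(1))U(1,0)|G(0)\rangle-\left.\sum_{\nu\ne G}\frac{e^{-i\phi_\nu}|\nu(1)\rangle\langle\dot\nu(s_1)|G(s_1)\rangle e^{-iT\int_0^{s_1}\gamma_{G,\nu}(\xi)\,d\xi}}{-i\gamma_{G,\nu}(s_1)T}\right|_{s_1=0}^{1}\right\|\le\frac{R}{T^2},$$ where $$R=\frac{2\|\ddot H\|+\|\dddot H\|}{\gamma_{\min}^3}+\frac{25\|\dot H\|\|\ddot H\|+16\|\dot H\|^2+\|\ddot H\|^2}{\gamma_{\min}^4}+\frac{12\|\ddot H\|\|\dot H\|^2+118\|\dot H\|^3}{\gamma_{\min}^5}+\frac{36\|\dot H\|^4}{\gamma_{\min}^6}+T^2\left[\left(1+\frac{\Gamma}{\|\dot H\|T}\right)\left(e^{\Gamma/(\gamma_{\min}T)}-1\right)-\frac{\Gamma}{\gamma_{\min}T}\right]$$ and $\Gamma=\frac{6\|\dot H\|^3}{\gamma_{\min}^3}+\frac{\|\dot H\|\|\ddot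 H\|}{\gamma_{\min}^2}+\frac{2\|\dot H\|^2}{\gamma_{\min}^2}$ (if $\|\dot H\|=0$, then $\Gamma=0$ and the bracket is read as $0$). -/

import Mathlib

open Set MeasureTheory

/-- The Hilbert space `ℂ^N` with its standard inner product, conjugate-linear in the first slot. -/
abbrev Ket (N : ℕ) : Type := EuclideanSpace ℂ (Fin N)

/-- Complex `N × N` matrices, seen as operators on `ℂ^N`; the norm is the operator norm. -/
abbrev Op (N : ℕ) : Type := Ket N →L[ℂ] Ket N

/-- `H` is three times differentiable on `[0,1]` (one-sided derivatives at the end points). -/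
def ThriceDifferentiable {N : ℕ} (H : ℝ → Op N) : Prop :=
  ∀ k < 3, DifferentiableOn ℝ (iteratedDerivWithin k H (Icc 0 1)) (Icc 0 1)

/-- `h` is the maximum (supremum) over `s ∈ [0,1]` of the norm of the `k`-th derivative of `H`. -/
def IsMaxNormDeriv {N : ℕ} (k : ℕ) (H : ℝ → Op N) (h : ℝ) : Prop :=
  IsLUB ((fun s => ‖iteratedDerivWithin k H (Icc 0 1) s‖) '' Icc 0 1) h

/-- `U` is the family of time-evolution operators `s ↦ U(s,0)` generated by `H` over the total
time `T`: the solution of `dU/ds = -i T H(s) U`, `U(0,0) = 1`, on `[0,1]`. -/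
structure IsTimeEvolution {N : ℕ} (H : ℝ → Op N) (T : ℝ) (U : ℝ → Op N) : Prop where
  initial : U 0 = 1
  schrodinger : ∀ s ∈ Icc (0 : ℝ) 1,
    HasDerivWithinAt U ((-(Complex.I * (T : ℂ))) • (H s * U s)) (Icc 0 1) s

/-- Two levels are degenerate if their energies coincide identically on `[0,1]`. -/
def DegenerateLevels {N : ℕ} (E : Fin N → ℝ → ℝ) (μ ν : Fin N) : Prop :=
  ∀ s ∈ Icc (0 : ℝ) 1, E μ s = E ν s

/-- The derivative of an instantaneous eigenstate on `[0,1]`. -/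
noncomputable def ketDeriv {N : ℕ} (f : ℝ → Ket N) (s : ℝ) : Ket N :=
  derivWithin f (Icc 0 1) s

/-- `ket ν s` (`ν = 0, …, N - 1`) is a differentiable orthonormal basis of instantaneous
eigenstates of `H s`, with energies `E ν s`, in the gauge in which `⟨μ̇(s)|ν(s)⟩` vanishes
whenever the levels `μ` and `ν` are degenerate (in particular for `μ = ν`). -/
structure IsInstantaneousEigenbasis {N : ℕ} (H : ℝ → Op N) (ket : Fin N → ℝ → Ket N)
    (E : Fin N → ℝ → ℝ) : Prop where
  orthonormal : ∀ s ∈ Icc (0 : ℝ) 1, Orthonormal ℂ (fun ν => ket ν s)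
  eigen : ∀ s ∈ Icc (0 : ℝ) 1, ∀ ν, H s (ket ν s) = (E ν s : ℂ) • ket ν s
  differentiable : ∀ ν, DifferentiableOn ℝ (ket ν) (Icc 0 1)
  gauge : ∀ μ ν, DegenerateLevels E μ ν →
    ∀ s ∈ Icc (0 : ℝ) 1, inner ℂ (ketDeriv (ket μ) s) (ket ν s) = 0

/-- The minimum gap between non-degenerate levels is at least `γ`. -/
def HasGap {N : ℕ} (E : Fin N → ℝ → ℝ) (γ : ℝ) : Prop :=
  ∀ μ ν, ¬ DegenerateLevels E μ ν → ∀ s ∈ Icc (0 : ℝ) 1, γ ≤ |E μ s - E ν s|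

/-- The eigenvalue gap `γ_{μ,ν}(s) = E_μ(s) - E_ν(s)`. -/
def gapFn {N : ℕ} (E : Fin N → ℝ → ℝ) (μ ν : Fin N) (s : ℝ) : ℝ := E μ s - E ν s

/-- The projector `|v⟩⟨v|` (for a unit vector `v`). -/
noncomputable def ketBra {N : ℕ} (v : Ket N) : Op N := InnerProductSpace.rankOne ℂ v v

/-- `∑_{ν ≠ G} e^{-iφ_ν} |ν(1)⟩ ⟨ν̇(s)|G(s)⟩ e^{-i ∫₀ˢ γ_{G,ν}(ξ) dξ T} / (-i γ_{G,ν}(s) T)`,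
where `φ_ν = ∫₀¹ E_ν(ξ) dξ T`. -/
noncomputable def boundaryTerm {N : ℕ} (ket : Fin N → ℝ → Ket N) (E : Fin N → ℝ → ℝ)
    (G : Fin N) (T s : ℝ) : Ket N :=
  ∑ ν ∈ Finset.univ.erase G,
    (Complex.exp (-Complex.I * (((∫ ξ in (0 : ℝ)..1, E ν ξ) * T : ℝ) : ℂ))
      * inner ℂ (ketDeriv (ket ν) s) (ket G s)
      * Complex.exp (-Complex.I * (((∫ ξ in (0 : ℝ)..s, gapFn E G ν ξ) * T : ℝ) : ℂ))
      / (-Complex.I * ((gapFn E G ν s : ℝ) : ℂ) * (T : ℂ))) • ket ν 1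

/-- `Γ` as a function of `h₁ = ‖Ḣ‖`, `h₂ = ‖Ḧ‖` and the gap `γ`. -/
noncomputable def adiabaticGamma (h₁ h₂ γ : ℝ) : ℝ :=
  (6 * h₁ ^ 3 / γ ^ 3 + h₁ * h₂ / γ ^ 2) + 2 * h₁ ^ 2 / γ ^ 2

/-- The bound on `R`, as a function of `h₁ = ‖Ḣ‖`, `h₂ = ‖Ḧ‖`, `h₃ = ‖H⃛‖`, the gap `γ` and `T`.
For `h₁ = 0` one has `Γ = 0`, and the bracket vanishes. -/
noncomputable def adiabaticR (h₁ h₂ h₃ γ T : ℝ) : ℝ :=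
  (2 * h₂ + h₃) / γ ^ 3
    + (25 * h₁ * h₂ + 16 * h₁ ^ 2 + h₂ ^ 2) / γ ^ 4
    + (12 * h₂ * h₁ ^ 2 + 118 * h₁ ^ 3) / γ ^ 5
    + 36 * h₁ ^ 4 / γ ^ 6
    + T ^ 2 * ((1 + adiabaticGamma h₁ h₂ γ / (h₁ * T))
          * (Real.exp (adiabaticGamma h₁ h₂ γ / (γ * T)) - 1)
        - adiabaticGamma h₁ h₂ γ / (γ * T))

/-!
The state `e^{-iTθ} G`, with `θ` the integral of the energy `E_G`, solves the Schrödinger equation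
up to a residual of size one. Adding corrections of order `T⁻¹` and `T⁻²` orthogonal to `G`, and
correcting the phase by the second-order energy shift, makes the residual of order `T⁻²`. Writing
`R` for the reduced resolvent of the level of `G`, the first correction is `-i R²Ḣ G`, which at
`s = 1`, up to the factor `T⁻¹` and the phase, is the boundary term; at `s = 0` it is what the
initial state `G(0)` lacks in order to follow the corrected solution. A function solving the
equation up to a residual `C` stays within `C` of the exact evolution
(`IsTimeEvolution.norm_sub_apply_le`), so the corrected state is transported up to `O(T⁻²)`
(`SpectralLevel.norm_second_order_le`).

What is missing at `s = 0` is a superposition of excited states, of norm `O(T⁻¹)`, and it suffices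
to transport it up to a relative error `O(T⁻¹)`. This is done level by level, by the same argument
with one correction less (`SpectralLevel.norm_evolution_sub_le`), and yields the boundary term at
`s = 0`. The sum over the levels costs only a factor `3 / 2`, whatever their number: the components
of `R²Ḣ G` decay as the inverse square of the energy difference to `G`, distinct levels are `γ`
apart, and the sum of `k⁻⁴` over the nonzero integers is at most `9 / 4`
(`IsInstantaneousEigenbasis.sum_sqrt_levels_le`).

All residuals are words in `R`, `P` and the derivatives of `H`, because
`Ġ = -R Ḣ G`, `Ṗ = -(R Ḣ P + P Ḣ R)` and
`Ṙ = -R (Ḣ - Ė) R + R R Ḣ P + P Ḣ R R`. Bounding them word by word gives a bound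
polynomial in the norms of the derivatives, which stays below the polynomial part of `adiabaticR`
when `‖Ḣ‖ ≤ γ² T`; the other case follows from the norms of the terms alone. The exponential bracket
in `adiabaticR` is used only through its nonnegativity.
-/

/-! ### Calculus on the unit interval -/

/-- The product rule for an operator-valued function applied to a vector-valued function. -/
lemma HasDerivWithinAt.op_apply {N : ℕ} {A : ℝ → Op N} {x : ℝ → Ket N} {A' : Op N} {x' : Ket N}
    {I : Set ℝ} {s : ℝ} (hA : HasDerivWithinAt A A' I s) (hx : HasDerivWithinAt x x' I s) :
    HasDerivWithinAt (fun s => A s (x s)) (A' (x s) + A s x') I s := by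
  let B : Op N →L[ℝ] Ket N →L[ℝ] Ket N :=
    LinearMap.mkContinuous₂ (LinearMap.mk₂ ℝ (fun (A : Op N) (x : Ket N) => A x)
      (fun _ _ _ => rfl) (fun _ _ _ => rfl) (fun _ _ _ => map_add _ _ _)
      (fun c A x => by simp)) 1
      (fun A x => by simpa using A.le_opNorm x)
  have h := B.hasDerivWithinAt_of_bilinear hA hx
  rw [add_comm] at h
  exact h

/-- The product rule for `s ↦ |x(s)⟩⟨y(s)|`. -/
lemma HasDerivWithinAt.rankOne {N : ℕ} {x y : ℝ → Ket N} {x' y' : Ket N}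
    {I : Set ℝ} {s : ℝ} (hx : HasDerivWithinAt x x' I s) (hy : HasDerivWithinAt y y' I s) :
    HasDerivWithinAt (fun s => (InnerProductSpace.rankOne ℂ (x s) (y s) : Op N))
      (InnerProductSpace.rankOne ℂ x' (y s) + InnerProductSpace.rankOne ℂ (x s) y') I s := by
  let B : Ket N →L[ℝ] Ket N →L[ℝ] Op N :=
    LinearMap.mkContinuous₂ (LinearMap.mk₂ ℝ
      (fun x y : Ket N => (InnerProductSpace.rankOne ℂ x y : Op N))
      (fun _ _ _ => by simp) (fun c x y => by ext; simp)
      (fun _ _ _ => by simp)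
      (fun c x y => by ext; simp [← Complex.coe_smul])) 1
      (fun x y => by simp)
  have h := B.hasDerivWithinAt_of_bilinear hx hy
  rw [add_comm] at h
  exact h

/-- The fundamental theorem of calculus on `[0,1]`, with one-sided derivatives at the end points. -/
lemma hasDerivWithinAt_integral_unitInterval {f : ℝ → ℝ} (hf : ContinuousOn f (Icc 0 1))
    {s : ℝ} (hs : s ∈ Icc (0 : ℝ) 1) :
    HasDerivWithinAt (fun u => ∫ ξ in (0 : ℝ)..u, f ξ) (f s) (Icc 0 1) s := by
  have : Fact (s ∈ Icc (0 : ℝ) 1) := ⟨hs⟩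
  refine intervalIntegral.integral_hasDerivWithinAt_right (t := Icc 0 1) ?_ ?_ (hf s hs)
  · refine ContinuousOn.intervalIntegrable (hf.mono ?_)
    rw [uIcc_of_le hs.1]
    exact Icc_subset_Icc_right hs.2
  · exact hf.stronglyMeasurableAtFilter_nhdsWithin measurableSet_Icc s

/-- `e^{-iθ(s)}` is differentiable along with `θ`. -/
lemma HasDerivWithinAt.phase {θ : ℝ → ℝ} {θ' : ℝ} {I : Set ℝ} {s : ℝ}
    (hθ : HasDerivWithinAt θ θ' I s) :
    HasDerivWithinAt (fun s => Complex.exp (-Complex.I * (θ s : ℂ)))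
      (-(Complex.I * θ') * Complex.exp (-Complex.I * (θ s : ℂ))) I s := by
  have := ((hθ.ofReal_comp).const_mul (-Complex.I)).cexp
  convert this using 1
  ring

lemma norm_phase (x : ℝ) : ‖Complex.exp (-Complex.I * (x : ℂ))‖ = 1 := by
  have := Complex.norm_exp_ofReal_mul_I (-x)
  rw [← this]; congr 2; push_cast; ring

lemma norm_phase_sub_one_le (x : ℝ) : ‖Complex.exp (-Complex.I * (x : ℂ)) - 1‖ ≤ |x| := by
  have := Real.norm_exp_I_mul_ofReal_sub_one_le (x := -x)
  rw [Real.norm_eq_abs, abs_neg] at this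
  convert this using 4
  push_cast; ring

/-! ### Exact evolution and approximate solutions -/

section Evolution

variable {N : ℕ} {H : ℝ → Op N} {T : ℝ} {U : ℝ → Op N}

lemma IsTimeEvolution.hasDerivWithinAt_star
    (hU : IsTimeEvolution H T U) (hH : ∀ s ∈ Icc (0 : ℝ) 1, IsSelfAdjoint (H s))
    {s : ℝ} (hs : s ∈ Icc (0 : ℝ) 1) :
    HasDerivWithinAt (fun s => star (U s)) ((Complex.I * (T : ℂ)) • (star (U s) * H s))
      (Icc 0 1) s := by
  refine (hU.schrodinger s hs).star.congr_deriv ?_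
  rw [star_smul, star_mul, (hH s hs).star_eq]
  simp

lemma IsTimeEvolution.star_mul_self
    (hU : IsTimeEvolution H T U) (hH : ∀ s ∈ Icc (0 : ℝ) 1, IsSelfAdjoint (H s))
    {s : ℝ} (hs : s ∈ Icc (0 : ℝ) 1) : star (U s) * U s = 1 := by
  have hd : ∀ x ∈ Icc (0 : ℝ) 1,
      HasDerivWithinAt (fun s => star (U s) * U s) ((fun _ => (0 : Op N)) x) (Icc 0 1) x := by
    intro x hx
    refine ((hU.hasDerivWithinAt_star hH hx).mul (hU.schrodinger x hx)).congr_deriv ?_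
    rw [smul_mul_assoc, mul_smul_comm, mul_assoc]
    module
  have := norm_image_sub_le_of_norm_deriv_le_segment' (C := 0) hd (by simp) s hs
  rw [zero_mul, norm_le_zero_iff, sub_eq_zero] at this
  simpa [hU.initial] using this

lemma IsTimeEvolution.mul_star_self
    (hU : IsTimeEvolution H T U) (hH : ∀ s ∈ Icc (0 : ℝ) 1, IsSelfAdjoint (H s))
    {s : ℝ} (hs : s ∈ Icc (0 : ℝ) 1) : U s * star (U s) = 1 := by
  have h := hU.star_mul_self hH hs
  apply ContinuousLinearMap.coe_injective
  have h' := congrArg ContinuousLinearMap.toLinearMap h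
  exact mul_eq_one_comm.mp h'

lemma norm_apply_of_star_mul_self {A : Op N} (hA : star A * A = 1) (x : Ket N) :
    ‖A x‖ = ‖x‖ := by
  have h : inner ℂ (A x) (A x) = inner ℂ x x := by
    rw [← ContinuousLinearMap.adjoint_inner_left, ← ContinuousLinearMap.star_eq_adjoint,
      ← mul_apply_eq_comp, hA, one_apply_eq_self]
  rw [@norm_eq_sqrt_re_inner ℂ, @norm_eq_sqrt_re_inner ℂ _ _ _ _ x, h]

/-- A function that solves the Schrödinger equation up to a residual of norm at most `C` stays
within `C` of the exact solution: in the frame that moves with `U` its derivative is the rotated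
residual. -/
lemma IsTimeEvolution.norm_sub_apply_le
    (hU : IsTimeEvolution H T U) (hH : ∀ s ∈ Icc (0 : ℝ) 1, IsSelfAdjoint (H s))
    {w w' : ℝ → Ket N} {C : ℝ}
    (hw : ∀ s ∈ Icc (0 : ℝ) 1, HasDerivWithinAt w (w' s) (Icc 0 1) s)
    (hC : ∀ s ∈ Icc (0 : ℝ) 1, ‖w' s + (Complex.I * (T : ℂ)) • H s (w s)‖ ≤ C) :
    ‖w 1 - U 1 (w 0)‖ ≤ C := by
  have h1 : (1 : ℝ) ∈ Icc (0 : ℝ) 1 := by simp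
  have hstar : ∀ s ∈ Icc (0 : ℝ) 1, ∀ x, ‖star (U s) x‖ = ‖x‖ := fun s hs =>
    norm_apply_of_star_mul_self (by rw [star_star]; exact hU.mul_star_self hH hs)
  have hd : ∀ s ∈ Icc (0 : ℝ) 1, HasDerivWithinAt (fun s => star (U s) (w s))
      (star (U s) (w' s + (Complex.I * (T : ℂ)) • H s (w s))) (Icc 0 1) s := by
    intro s hs
    convert (hU.hasDerivWithinAt_star hH hs).op_apply (hw s hs) using 1
    simp [add_comm]
  have key := norm_image_sub_le_of_norm_deriv_le_segment_01' hd (fun s hs => by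
    rw [hstar s (Ico_subset_Icc_self hs)]; exact hC s (Ico_subset_Icc_self hs))
  have e : w 1 - U 1 (w 0) = U 1 (star (U 1) (w 1) - star (U 0) (w 0)) := by
    rw [map_sub, ← mul_apply_eq_comp, hU.mul_star_self hH h1, hU.initial]
    simp
  rw [e, norm_apply_of_star_mul_self (hU.star_mul_self hH h1)]
  exact key

end Evolution

/-! ### Norm bounds for the coefficients of the adiabatic expansion -/

section NormedRing

variable {A : Type*} [NormedRing A] {P R Y Y' D H₁ H₂ H₃ : A} {ρ h₁ h₂ h₃ : ℝ}

lemma norm_add_three_le {V : Type*} [SeminormedAddCommGroup V] {a b c : V} {x y z : ℝ}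
    (ha : ‖a‖ ≤ x) (hb : ‖b‖ ≤ y) (hc : ‖c‖ ≤ z) : ‖a + b + c‖ ≤ x + y + z :=
  norm_add_le_of_le (norm_add_le_of_le ha hb) hc

/-- The derivative of the reduced resolvent `R` is a sum of three words; the next two lemmas gain
over this bound because `P R = R P = 0` removes one of the words in a product with `R`. -/
lemma norm_resolventDeriv_le (hP : ‖P‖ ≤ 1) (hR : ‖R‖ ≤ ρ) (hY : ‖Y‖ ≤ 2 * h₁)
    (hH₁ : ‖H₁‖ ≤ h₁) : ‖-(R * Y * R) + R * R * H₁ * P + P * H₁ * R * R‖ ≤ 4 * (ρ ^ 2 * h₁) := by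
  have a1 := norm_mul_le_of_le (norm_mul_le_of_le hR hY) hR
  have a2 := norm_mul_le_of_le (norm_mul_le_of_le (norm_mul_le_of_le hR hR) hH₁) hP
  have a3 := norm_mul_le_of_le (norm_mul_le_of_le (norm_mul_le_of_le hP hH₁) hR) hR
  rw [← norm_neg] at a1
  exact (norm_add_three_le a1 a2 a3).trans_eq (by ring)

lemma norm_resolventDeriv_mul_le (hP : ‖P‖ ≤ 1) (hR : ‖R‖ ≤ ρ) (hY : ‖Y‖ ≤ 2 * h₁)
    (hH₁ : ‖H₁‖ ≤ h₁) (hPR : P * R = 0) :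
    ‖(-(R * Y * R) + R * R * H₁ * P + P * H₁ * R * R) * R‖ ≤ 3 * (ρ ^ 3 * h₁) := by
  have a1 := norm_mul_le_of_le (norm_mul_le_of_le (norm_mul_le_of_le hR hY) hR) hR
  have a3 := norm_mul_le_of_le (norm_mul_le_of_le (norm_mul_le_of_le (norm_mul_le_of_le
    hP hH₁) hR) hR) hR
  rw [← norm_neg] at a1
  have e : (-(R * Y * R) + R * R * H₁ * P + P * H₁ * R * R) * R
      = -(R * Y * R * R) + P * H₁ * R * R * R := by
    simp only [add_mul, neg_mul, mul_assoc, hPR, mul_zero, add_zero]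
  rw [e]
  exact (norm_add_le_of_le a1 a3).trans_eq (by ring)

lemma norm_mul_resolventDeriv_le (hP : ‖P‖ ≤ 1) (hR : ‖R‖ ≤ ρ) (hY : ‖Y‖ ≤ 2 * h₁)
    (hH₁ : ‖H₁‖ ≤ h₁) (hRP : R * P = 0) :
    ‖R * (-(R * Y * R) + R * R * H₁ * P + P * H₁ * R * R)‖ ≤ 3 * (ρ ^ 3 * h₁) := by
  have a1 := norm_mul_le_of_le (norm_mul_le_of_le (norm_mul_le_of_le hR hR) hY) hR
  have a3 := norm_mul_le_of_le (norm_mul_le_of_le (norm_mul_le_of_le (norm_mul_le_of_le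
    hR hR) hR) hH₁) hP
  rw [← norm_neg] at a1
  have e : R * (-(R * Y * R) + R * R * H₁ * P + P * H₁ * R * R)
      = -(R * R * Y * R) + R * R * R * H₁ * P := by
    simp only [mul_add, mul_neg, ← mul_assoc, hRP, zero_mul, add_zero]
  rw [e]
  exact (norm_add_le_of_le a1 a3).trans_eq (by ring)

/-- The operator taking a parallel eigenvector `n` to the derivative of `R²Ḣ n`. Here `R` is the
reduced resolvent, `P` the spectral projector and `Y` the derivative of `H - E`. -/
def firstCoeffDeriv (P R Y H₁ H₂ : A) : A :=
  -(R * Y * R * R * H₁) + P * H₁ * R * R * R * H₁ - (R * R * Y * R * H₁ + R * R * Y * R * H₁)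
    + R * R * H₂

/-- The operator taking the eigenvector to the coefficient of `T⁻²` in the adiabatic expansion. -/
def secondCoeff (R Y H₁ H₂ : A) : A :=
  -(R * R * Y * R * R * H₁) - (R * R * R * Y * R * H₁ + R * R * R * Y * R * H₁) + R * R * R * H₂

lemma mul_firstCoeffDeriv (hRP : R * P = 0) :
    R * firstCoeffDeriv P R Y H₁ H₂ = secondCoeff R Y H₁ H₂ := by
  simp only [firstCoeffDeriv, secondCoeff, mul_add, mul_sub, mul_neg, ← mul_assoc, hRP, zero_mul,
    add_zero]

lemma projector_mul_firstCoeffDeriv (hPR : P * R = 0) (hPP : P * P = P) :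
    P * firstCoeffDeriv P R Y H₁ H₂ = P * H₁ * R * R * R * H₁ := by
  simp only [firstCoeffDeriv, mul_add, mul_sub, mul_neg, ← mul_assoc, hPR, hPP, zero_mul,
    neg_zero, zero_add, sub_zero, add_zero]

lemma norm_firstCoeffDeriv_le (hP : ‖P‖ ≤ 1) (hR : ‖R‖ ≤ ρ) (hY : ‖Y‖ ≤ 2 * h₁)
    (hH₁ : ‖H₁‖ ≤ h₁) (hH₂ : ‖H₂‖ ≤ h₂) :
    ‖firstCoeffDeriv P R Y H₁ H₂‖ ≤ ρ ^ 2 * h₂ + 7 * (ρ ^ 3 * h₁ ^ 2) := by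
  have a1 := norm_mul_le_of_le (norm_mul_le_of_le (norm_mul_le_of_le (norm_mul_le_of_le
    hR hY) hR) hR) hH₁
  have a2 := norm_mul_le_of_le (norm_mul_le_of_le (norm_mul_le_of_le (norm_mul_le_of_le
    (norm_mul_le_of_le hP hH₁) hR) hR) hR) hH₁
  have a3 := norm_mul_le_of_le (norm_mul_le_of_le (norm_mul_le_of_le (norm_mul_le_of_le
    hR hR) hY) hR) hH₁
  have a4 := norm_mul_le_of_le (norm_mul_le_of_le hR hR) hH₂
  rw [← norm_neg] at a1
  exact (norm_add_le_of_le (norm_sub_le_of_le (norm_add_le_of_le a1 a2)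
    (norm_add_le_of_le a3 a3)) a4).trans_eq (by ring)

lemma norm_secondCoeff_le (hR : ‖R‖ ≤ ρ) (hY : ‖Y‖ ≤ 2 * h₁)
    (hH₁ : ‖H₁‖ ≤ h₁) (hH₂ : ‖H₂‖ ≤ h₂) :
    ‖secondCoeff R Y H₁ H₂‖ ≤ ρ ^ 3 * h₂ + 6 * (ρ ^ 4 * h₁ ^ 2) := by
  have a1 := norm_mul_le_of_le (norm_mul_le_of_le (norm_mul_le_of_le (norm_mul_le_of_le
    (norm_mul_le_of_le hR hR) hY) hR) hR) hH₁
  have a3 := norm_mul_le_of_le (norm_mul_le_of_le (norm_mul_le_of_le (norm_mul_le_of_le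
    (norm_mul_le_of_le hR hR) hR) hY) hR) hH₁
  have a4 := norm_mul_le_of_le (norm_mul_le_of_le (norm_mul_le_of_le hR hR) hR) hH₂
  rw [← norm_neg] at a1
  exact (norm_add_le_of_le (norm_sub_le_of_le a1 (norm_add_le_of_le a3 a3)) a4).trans_eq (by ring)

/-- The derivative of `secondCoeff`, by the product rule, when `R`, `Y`, `H₁`, `H₂` have the
derivatives `D`, `Y'`, `H₂`, `H₃`. -/
def secondCoeffDeriv (R D Y Y' H₁ H₂ H₃ : A) : A :=
  let w₁ := D * R * (Y * R * R * H₁) + R * D * (Y * R * R * H₁) + R * R * Y' * R * R * H₁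
    + R * R * Y * (D * R) * H₁ + R * R * Y * (R * D) * H₁ + R * R * Y * R * R * H₂
  let w₂ := D * R * (R * Y * R * H₁) + R * D * (R * Y * R * H₁) + R * (R * D) * (Y * R * H₁)
    + R * R * R * Y' * R * H₁ + R * R * R * Y * D * H₁ + R * R * R * Y * R * H₂
  let w₃ := D * R * (R * H₂) + R * D * (R * H₂) + R * (R * D) * H₂ + R * R * R * H₃
  w₃ - w₁ - (w₂ + w₂)

/-- The bound on the derivative of the second coefficient along an eigenvector, whose own
derivative is `-R H₁` applied to it. -/
lemma norm_secondCoeffDeriv_le (hR : ‖R‖ ≤ ρ) (hY : ‖Y‖ ≤ 2 * h₁)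
    (hY' : ‖Y'‖ ≤ 2 * h₂ + 2 * (ρ * h₁ ^ 2))
    (hH₁ : ‖H₁‖ ≤ h₁) (hH₂ : ‖H₂‖ ≤ h₂) (hH₃ : ‖H₃‖ ≤ h₃)
    (hD : ‖D‖ ≤ 4 * (ρ ^ 2 * h₁)) (hDR : ‖D * R‖ ≤ 3 * (ρ ^ 3 * h₁))
    (hRD : ‖R * D‖ ≤ 3 * (ρ ^ 3 * h₁)) :
    ‖secondCoeffDeriv R D Y Y' H₁ H₂ H₃ - secondCoeff R Y H₁ H₂ * (R * H₁)‖
      ≤ ρ ^ 3 * h₃ + 22 * (ρ ^ 4 * h₁ * h₂) + 88 * (ρ ^ 5 * h₁ ^ 3) := by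
  have hYRRH := norm_mul_le_of_le (norm_mul_le_of_le (norm_mul_le_of_le hY hR) hR) hH₁
  have hRYRH := norm_mul_le_of_le (norm_mul_le_of_le (norm_mul_le_of_le hR hY) hR) hH₁
  have hYRH := norm_mul_le_of_le (norm_mul_le_of_le hY hR) hH₁
  have hRR := norm_mul_le_of_le hR hR
  have hRRR := norm_mul_le_of_le hRR hR
  have w1 := norm_add_le_of_le (norm_add_three_le (norm_add_three_le
    (norm_mul_le_of_le hDR hYRRH) (norm_mul_le_of_le hRD hYRRH)
    (norm_mul_le_of_le (norm_mul_le_of_le (norm_mul_le_of_le (norm_mul_le_of_le hRR hY') hR) hR)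
      hH₁))
    (norm_mul_le_of_le (norm_mul_le_of_le (norm_mul_le_of_le hRR hY) hDR) hH₁)
    (norm_mul_le_of_le (norm_mul_le_of_le (norm_mul_le_of_le hRR hY) hRD) hH₁))
    (norm_mul_le_of_le (norm_mul_le_of_le (norm_mul_le_of_le (norm_mul_le_of_le hRR hY) hR) hR)
      hH₂)
  have w2 := norm_add_le_of_le (norm_add_three_le (norm_add_three_le
    (norm_mul_le_of_le hDR hRYRH) (norm_mul_le_of_le hRD hRYRH)
    (norm_mul_le_of_le (norm_mul_le_of_le hR hRD) hYRH))
    (norm_mul_le_of_le (norm_mul_le_of_le (norm_mul_le_of_le hRRR hY') hR) hH₁)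
    (norm_mul_le_of_le (norm_mul_le_of_le (norm_mul_le_of_le hRRR hY) hD) hH₁))
    (norm_mul_le_of_le (norm_mul_le_of_le (norm_mul_le_of_le hRRR hY) hR) hH₂)
  have w3 := norm_add_le_of_le (norm_add_three_le
    (norm_mul_le_of_le hDR (norm_mul_le_of_le hR hH₂))
    (norm_mul_le_of_le hRD (norm_mul_le_of_le hR hH₂))
    (norm_mul_le_of_le (norm_mul_le_of_le hR hRD) hH₂))
    (norm_mul_le_of_le hRRR hH₃)
  have w4 := norm_mul_le_of_le (norm_secondCoeff_le hR hY hH₁ hH₂) (norm_mul_le_of_le hR hH₁)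
  refine (norm_sub_le_of_le (norm_sub_le_of_le (norm_sub_le_of_le w3 w1) (norm_add_le_of_le w2 w2))
    w4).trans_eq ?_
  ring

/-- The product rule for `R²Ḣ n` when `ṅ = -R Ḣ n`, read off on the range of `P`. -/
lemma firstCoeffDeriv_eq [NormedAlgebra ℝ A] {e : ℝ} (hRP : R * P = 0) (hPR : P * R = 0)
    (hPHP : P * H₁ * P = e • P) (hD : D = -(R * (H₁ - e • 1) * R) + R * R * H₁ * P + P * H₁ * R * R) :
    ((D * R + R * D) * H₁ + R * R * H₂ - R * R * H₁ * (R * H₁)) * P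
      = firstCoeffDeriv P R (H₁ - e • 1) H₁ H₂ * P := by
  have r1 : ∀ x, R * (P * x) = 0 := fun x => by rw [← mul_assoc, hRP, zero_mul]
  have r2 : ∀ x, P * (R * x) = 0 := fun x => by rw [← mul_assoc, hPR, zero_mul]
  rw [mul_assoc] at hPHP
  simp only [firstCoeffDeriv, hD, mul_add, add_mul, mul_sub, sub_mul, neg_mul, mul_neg, mul_assoc,
    smul_mul_assoc, mul_smul_comm, mul_one, r1, r2, hPHP, mul_zero, zero_mul]
  module

end NormedRing

/-! ### Spectral levels -/

/-- A family of Hermitian operators on `[0,1]` with three derivatives `H₁`, `H₂`, `H₃`, bounded in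
norm by `h₁`, `h₂`, `h₃`. -/
structure SmoothHamiltonian {N : ℕ} (H H₁ H₂ H₃ : ℝ → Op N) (h₁ h₂ h₃ : ℝ) : Prop where
  isSelfAdjoint : ∀ s ∈ Icc (0 : ℝ) 1, IsSelfAdjoint (H s)
  isSelfAdjoint_deriv : ∀ s ∈ Icc (0 : ℝ) 1, IsSelfAdjoint (H₁ s)
  hasDeriv : ∀ s ∈ Icc (0 : ℝ) 1, HasDerivWithinAt H (H₁ s) (Icc 0 1) s
  hasDeriv_one : ∀ s ∈ Icc (0 : ℝ) 1, HasDerivWithinAt H₁ (H₂ s) (Icc 0 1) s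
  hasDeriv_two : ∀ s ∈ Icc (0 : ℝ) 1, HasDerivWithinAt H₂ (H₃ s) (Icc 0 1) s
  norm_one_le : ∀ s ∈ Icc (0 : ℝ) 1, ‖H₁ s‖ ≤ h₁
  norm_two_le : ∀ s ∈ Icc (0 : ℝ) 1, ‖H₂ s‖ ≤ h₂
  norm_three_le : ∀ s ∈ Icc (0 : ℝ) 1, ‖H₃ s‖ ≤ h₃

/-- An energy `E` of `H`, with derivative `E₁`, together with its spectral projector `P` and its
reduced resolvent `R`, the inverse of `H - E` on the orthogonal complement of the range of `P`,
extended by zero. The number `ρ` bounds the resolvent, so it is the inverse of the gap around `E`.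
The formula for the derivative of `R` is part of the structure. -/
structure SpectralLevel {N : ℕ} (H H₁ : ℝ → Op N) (E E₁ : ℝ → ℝ) (P R : ℝ → Op N) (ρ : ℝ) :
    Prop where
  norm_P_le : ∀ s ∈ Icc (0 : ℝ) 1, ‖P s‖ ≤ 1
  norm_R_le : ∀ s ∈ Icc (0 : ℝ) 1, ‖R s‖ ≤ ρ
  isSelfAdjoint_R : ∀ s ∈ Icc (0 : ℝ) 1, IsSelfAdjoint (R s)
  P_mul_P : ∀ s ∈ Icc (0 : ℝ) 1, P s * P s = P s
  R_mul_P : ∀ s ∈ Icc (0 : ℝ) 1, R s * P s = 0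
  P_mul_R : ∀ s ∈ Icc (0 : ℝ) 1, P s * R s = 0
  H_mul_P : ∀ s ∈ Icc (0 : ℝ) 1, H s * P s = E s • P s
  H_mul_R : ∀ s ∈ Icc (0 : ℝ) 1, H s * R s = E s • R s + 1 - P s
  P_mul_H₁_mul_P : ∀ s ∈ Icc (0 : ℝ) 1, P s * H₁ s * P s = E₁ s • P s
  abs_E₁_le : ∀ s ∈ Icc (0 : ℝ) 1, |E₁ s| ≤ ‖H₁ s‖
  hasDeriv_R : ∀ s ∈ Icc (0 : ℝ) 1, HasDerivWithinAt R
    (-(R s * (H₁ s - E₁ s • 1) * R s) + R s * R s * H₁ s * P s + P s * H₁ s * R s * R s)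
    (Icc 0 1) s

/-- A curve of eigenvectors in the range of `P` that is parallel: its derivative has no component
in the range of `P`, which by first-order perturbation theory makes it `-R Ḣ n`. -/
structure ParallelEigenvector {N : ℕ} (H₁ P R : ℝ → Op N) (n : ℝ → Ket N) : Prop where
  P_apply : ∀ s ∈ Icc (0 : ℝ) 1, P s (n s) = n s
  hasDeriv : ∀ s ∈ Icc (0 : ℝ) 1, HasDerivWithinAt n (-(R s (H₁ s (n s)))) (Icc 0 1) s

section Level

variable {N : ℕ} {H H₁ H₂ H₃ : ℝ → Op N} {h₁ h₂ h₃ : ℝ} {E E₁ E₂ : ℝ → ℝ} {P R : ℝ → Op N} {ρ : ℝ}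
  {n : ℝ → Ket N}

lemma norm_apply_le_of_le {A : Op N} {x : Ket N} {a b : ℝ} (hA : ‖A‖ ≤ a) (hx : ‖x‖ ≤ b) :
    ‖A x‖ ≤ a * b :=
  (A.le_opNorm x).trans (mul_le_mul hA hx (norm_nonneg _) ((norm_nonneg _).trans hA))

lemma inner_selfAdjoint {A : Op N} (hA : IsSelfAdjoint A) (x y : Ket N) :
    (inner ℂ (A x) y : ℂ) = inner ℂ x (A y) := by
  conv_lhs => rw [← hA.star_eq, ContinuousLinearMap.star_eq_adjoint,
    ContinuousLinearMap.adjoint_inner_left]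

lemma SpectralLevel.norm_sub_smul_le (hH : SmoothHamiltonian H H₁ H₂ H₃ h₁ h₂ h₃)
    (hL : SpectralLevel H H₁ E E₁ P R ρ) {s : ℝ} (hs : s ∈ Icc (0 : ℝ) 1) :
    ‖H₁ s - E₁ s • (1 : Op N)‖ ≤ 2 * h₁ := by
  have h1 := hH.norm_one_le s hs
  have h2 : ‖E₁ s • (1 : Op N)‖ ≤ h₁ * 1 := by
    rw [norm_smul, Real.norm_eq_abs]
    exact mul_le_mul ((hL.abs_E₁_le s hs).trans h1) ContinuousLinearMap.norm_id_le
      (norm_nonneg _) ((norm_nonneg _).trans h1)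
  exact (norm_sub_le_of_le h1 h2).trans_eq (by ring)

lemma SpectralLevel.H_apply (hL : SpectralLevel H H₁ E E₁ P R ρ)
    (hn : ParallelEigenvector H₁ P R n) {s : ℝ} (hs : s ∈ Icc (0 : ℝ) 1) :
    H s (n s) = (E s : ℂ) • n s := by
  have h := congrArg (fun A : Op N => A (n s)) (hL.H_mul_P s hs)
  simpa [hn.P_apply s hs] using h

lemma SpectralLevel.H_R_apply (hL : SpectralLevel H H₁ E E₁ P R ρ) {s : ℝ}
    (hs : s ∈ Icc (0 : ℝ) 1) (x : Ket N) :
    H s (R s x) = (E s : ℂ) • R s x + x - P s x := by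
  have h := congrArg (fun A : Op N => A x) (hL.H_mul_R s hs)
  simpa using h

lemma SpectralLevel.P_R_apply (hL : SpectralLevel H H₁ E E₁ P R ρ) {s : ℝ}
    (hs : s ∈ Icc (0 : ℝ) 1) (x : Ket N) : P s (R s x) = 0 := by
  have h := congrArg (fun A : Op N => A x) (hL.P_mul_R s hs)
  simpa using h

/-- `d/ds (R²Ḣ n)` along a parallel eigenvector. -/
lemma SpectralLevel.hasDeriv_first (hH : SmoothHamiltonian H H₁ H₂ H₃ h₁ h₂ h₃)
    (hL : SpectralLevel H H₁ E E₁ P R ρ) (hn : ParallelEigenvector H₁ P R n)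
    {s : ℝ} (hs : s ∈ Icc (0 : ℝ) 1) :
    HasDerivWithinAt (fun s => (R s * R s * H₁ s) (n s))
      (firstCoeffDeriv (P s) (R s) (H₁ s - E₁ s • 1) (H₁ s) (H₂ s) (n s)) (Icc 0 1) s := by
  have hR := hL.hasDeriv_R s hs
  refine (((hR.mul hR).mul (hH.hasDeriv_one s hs)).op_apply (hn.hasDeriv s hs)).congr_deriv ?_
  have h := congrArg (fun A : Op N => A (n s)) (firstCoeffDeriv_eq (H₂ := H₂ s)
    (hL.R_mul_P s hs) (hL.P_mul_R s hs) (hL.P_mul_H₁_mul_P s hs) rfl)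
  simp only [mul_apply_eq_comp _ (P s), hn.P_apply s hs] at h
  rw [← h, sub_apply, map_neg, ← sub_eq_add_neg]
  rfl

lemma SpectralLevel.norm_first_le (hH : SmoothHamiltonian H H₁ H₂ H₃ h₁ h₂ h₃)
    (hL : SpectralLevel H H₁ E E₁ P R ρ) {s : ℝ} (hs : s ∈ Icc (0 : ℝ) 1) :
    ‖R s * R s * H₁ s‖ ≤ ρ ^ 2 * h₁ :=
  (norm_mul_le_of_le (norm_mul_le_of_le (hL.norm_R_le s hs) (hL.norm_R_le s hs))
    (hH.norm_one_le s hs)).trans_eq (by ring)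

/-- The adiabatic theorem to first order, for a single level: the evolution takes the initial
eigenvector to the final one, up to its dynamical phase and an error of order `T⁻¹`. -/
lemma SpectralLevel.norm_evolution_sub_le (hH : SmoothHamiltonian H H₁ H₂ H₃ h₁ h₂ h₃)
    (hL : SpectralLevel H H₁ E E₁ P R ρ) (hn : ParallelEigenvector H₁ P R n)
    {T : ℝ} (hT : 0 < T) {U : ℝ → Op N} (hU : IsTimeEvolution H T U) {θ : ℝ → ℝ}
    (hθ : ∀ s ∈ Icc (0 : ℝ) 1, HasDerivWithinAt θ (E s) (Icc 0 1) s) (hθ0 : θ 0 = 0)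
    {b : ℝ} (hb : ∀ s ∈ Icc (0 : ℝ) 1, ‖n s‖ ≤ b) :
    ‖U 1 (n 0) - Complex.exp (-Complex.I * ((θ 1 * T : ℝ) : ℂ)) • n 1‖
      ≤ T⁻¹ * (2 * (ρ ^ 2 * h₁) + ρ ^ 2 * h₂ + 7 * (ρ ^ 3 * h₁ ^ 2)) * b := by
  have m0 : (0 : ℝ) ∈ Icc (0 : ℝ) 1 := by simp
  have m1 : (1 : ℝ) ∈ Icc (0 : ℝ) 1 := by simp
  have hTc : (T : ℂ) ≠ 0 := by exact_mod_cast hT.ne'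
  set φ : ℝ → ℂ := fun s => Complex.exp (-Complex.I * ((θ s * T : ℝ) : ℂ)) with hφ
  have hφn : ∀ s, ‖φ s‖ = 1 := fun s => norm_phase _
  have hφ0 : φ 0 = 1 := by simp [hφ, hθ0]
  set F : ℝ → Ket N := fun s => (R s * R s * H₁ s) (n s) with hF
  set K : ℝ → Ket N := fun s =>
    firstCoeffDeriv (P s) (R s) (H₁ s - E₁ s • 1) (H₁ s) (H₂ s) (n s) with hK
  have hFb : ∀ s ∈ Icc (0 : ℝ) 1, ‖F s‖ ≤ ρ ^ 2 * h₁ * b := fun s hs =>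
    norm_apply_le_of_le (hL.norm_first_le hH hs) (hb s hs)
  have hHF : ∀ s ∈ Icc (0 : ℝ) 1, H s (F s) = (E s : ℂ) • F s + R s (H₁ s (n s)) := by
    intro s hs
    have := hL.H_R_apply hs (R s (H₁ s (n s)))
    rw [hL.P_R_apply hs, sub_zero] at this
    exact this
  have hτ : ‖(Complex.I * (T : ℂ)⁻¹ : ℂ)‖ = T⁻¹ := by simp [abs_of_pos hT]
  -- The eigenvector with its first correction, for which the residual is of order `T⁻¹`.
  have key := hU.norm_sub_apply_le hH.isSelfAdjoint
    (w := fun s => φ s • (n s - (Complex.I * (T : ℂ)⁻¹) • F s))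
    (w' := fun s => φ s • (-(R s (H₁ s (n s))) - (Complex.I * (T : ℂ)⁻¹) • K s)
      + (-(Complex.I * ((E s * T : ℝ) : ℂ)) * φ s) • (n s - (Complex.I * (T : ℂ)⁻¹) • F s))
    (C := T⁻¹ * ((ρ ^ 2 * h₂ + 7 * (ρ ^ 3 * h₁ ^ 2)) * b))
    (fun s hs => ((hθ s hs).mul_const T).phase.smul
      ((hn.hasDeriv s hs).sub ((hL.hasDeriv_first hH hn hs).const_smul (Complex.I * (T : ℂ)⁻¹))))
    (by
      intro s hs
      have e : φ s • (-(R s (H₁ s (n s))) - (Complex.I * (T : ℂ)⁻¹) • K s)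
          + (-(Complex.I * ((E s * T : ℝ) : ℂ)) * φ s) • (n s - (Complex.I * (T : ℂ)⁻¹) • F s)
          + (Complex.I * (T : ℂ)) • H s (φ s • (n s - (Complex.I * (T : ℂ)⁻¹) • F s))
          = φ s • -((Complex.I * (T : ℂ)⁻¹) • K s) := by
        rw [map_smul, map_sub, map_smul, hHF s hs, hL.H_apply hn hs]
        push_cast
        match_scalars <;> field_simp <;> ring_nf
        simp
      rw [e, norm_smul, hφn, one_mul, norm_neg, norm_smul, hτ]
      refine mul_le_mul_of_nonneg_left (norm_apply_le_of_le ?_ (hb s hs)) (inv_nonneg.2 hT.le)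
      exact norm_firstCoeffDeriv_le (hL.norm_P_le s hs) (hL.norm_R_le s hs)
        (hL.norm_sub_smul_le hH hs) (hH.norm_one_le s hs) (hH.norm_two_le s hs))
  have hUn := norm_apply_of_star_mul_self (hU.star_mul_self hH.isSelfAdjoint m1)
  have e : U 1 (n 0) - φ 1 • n 1
      = -(φ 1 • (n 1 - (Complex.I * (T : ℂ)⁻¹) • F 1)
          - U 1 (φ 0 • (n 0 - (Complex.I * (T : ℂ)⁻¹) • F 0)))
        - φ 1 • ((Complex.I * (T : ℂ)⁻¹) • F 1) + U 1 ((Complex.I * (T : ℂ)⁻¹) • F 0) := by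
    rw [hφ0, one_smul, map_sub]
    module
  have k1 : ‖φ 1 • ((Complex.I * (T : ℂ)⁻¹) • F 1)‖ ≤ T⁻¹ * (ρ ^ 2 * h₁ * b) := by
    rw [norm_smul, hφn, one_mul, norm_smul, hτ]
    exact mul_le_mul_of_nonneg_left (hFb 1 m1) (inv_nonneg.2 hT.le)
  have k2 : ‖U 1 ((Complex.I * (T : ℂ)⁻¹) • F 0)‖ ≤ T⁻¹ * (ρ ^ 2 * h₁ * b) := by
    rw [hUn, norm_smul, hτ]
    exact mul_le_mul_of_nonneg_left (hFb 0 m0) (inv_nonneg.2 hT.le)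
  rw [e]
  refine (norm_add_le_of_le (norm_sub_le_of_le ((norm_neg _).trans_le key) k1) k2).trans_eq ?_
  ring

end Level

/-! ### The expansion to second order for a non-degenerate level -/

section Nondegenerate

variable {N : ℕ} {H H₁ H₂ H₃ : ℝ → Op N} {h₁ h₂ h₃ : ℝ} {E E₁ E₂ : ℝ → ℝ} {P R : ℝ → Op N} {ρ : ℝ}
  {n : ℝ → Ket N}

lemma HasDerivWithinAt.secondCoeff {R D Y Y' H₁ H₂ H₃ : ℝ → Op N} {I : Set ℝ} {s : ℝ}
    (hR : HasDerivWithinAt R (D s) I s) (hY : HasDerivWithinAt Y (Y' s) I s)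
    (hH₁ : HasDerivWithinAt H₁ (H₂ s) I s) (hH₂ : HasDerivWithinAt H₂ (H₃ s) I s) :
    HasDerivWithinAt (fun s => secondCoeff (R s) (Y s) (H₁ s) (H₂ s))
      (secondCoeffDeriv (R s) (D s) (Y s) (Y' s) (H₁ s) (H₂ s) (H₃ s)) I s := by
  have h2 := (((((hR.mul hR).mul hR).mul hY).mul hR).mul hH₁)
  refine ((((((((hR.mul hR).mul hY).mul hR).mul hR).mul hH₁).neg.sub (h2.add h2))).add
    (((hR.mul hR).mul hR).mul hH₂)).congr_deriv ?_
  simp only [secondCoeffDeriv, Pi.mul_apply]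
  noncomm_ring

/-- `d/ds` of the coefficient of `T⁻²` along a parallel eigenvector. -/
lemma SpectralLevel.hasDeriv_second (hH : SmoothHamiltonian H H₁ H₂ H₃ h₁ h₂ h₃)
    (hL : SpectralLevel H H₁ E E₁ P R ρ) (hn : ParallelEigenvector H₁ P R n)
    (hE₁ : ∀ s ∈ Icc (0 : ℝ) 1, HasDerivWithinAt E₁ (E₂ s) (Icc 0 1) s)
    {s : ℝ} (hs : s ∈ Icc (0 : ℝ) 1) :
    HasDerivWithinAt (fun s => secondCoeff (R s) (H₁ s - E₁ s • 1) (H₁ s) (H₂ s) (n s))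
      ((secondCoeffDeriv (R s)
        (-(R s * (H₁ s - E₁ s • 1) * R s) + R s * R s * H₁ s * P s + P s * H₁ s * R s * R s)
        (H₁ s - E₁ s • 1) (H₂ s - E₂ s • 1) (H₁ s) (H₂ s) (H₃ s)
        - secondCoeff (R s) (H₁ s - E₁ s • 1) (H₁ s) (H₂ s) * (R s * H₁ s)) (n s))
      (Icc 0 1) s := by
  have hY : HasDerivWithinAt (fun s => H₁ s - E₁ s • (1 : Op N)) (H₂ s - E₂ s • 1) (Icc 0 1) s :=
    (hH.hasDeriv_one s hs).sub ((hE₁ s hs).smul_const (1 : Op N))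
  have h := HasDerivWithinAt.secondCoeff
    (D := fun s => -(R s * (H₁ s - E₁ s • 1) * R s) + R s * R s * H₁ s * P s
      + P s * H₁ s * R s * R s)
    (Y' := fun s => H₂ s - E₂ s • 1) (hL.hasDeriv_R s hs) hY (hH.hasDeriv_one s hs)
    (hH.hasDeriv_two s hs)
  refine (h.op_apply (hn.hasDeriv s hs)).congr_deriv ?_
  rw [map_neg, ← sub_eq_add_neg, sub_apply]
  rfl

lemma SpectralLevel.norm_second_deriv_le (hH : SmoothHamiltonian H H₁ H₂ H₃ h₁ h₂ h₃)
    (hL : SpectralLevel H H₁ E E₁ P R ρ)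
    (hE₂ : ∀ s ∈ Icc (0 : ℝ) 1, |E₂ s| ≤ h₂ + 2 * (ρ * h₁ ^ 2))
    {s : ℝ} (hs : s ∈ Icc (0 : ℝ) 1) :
    ‖secondCoeffDeriv (R s)
        (-(R s * (H₁ s - E₁ s • 1) * R s) + R s * R s * H₁ s * P s + P s * H₁ s * R s * R s)
        (H₁ s - E₁ s • 1) (H₂ s - E₂ s • 1) (H₁ s) (H₂ s) (H₃ s)
        - secondCoeff (R s) (H₁ s - E₁ s • 1) (H₁ s) (H₂ s) * (R s * H₁ s)‖
      ≤ ρ ^ 3 * h₃ + 22 * (ρ ^ 4 * h₁ * h₂) + 88 * (ρ ^ 5 * h₁ ^ 3) := by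
  have hP := hL.norm_P_le s hs
  have hR := hL.norm_R_le s hs
  have h1 := hH.norm_one_le s hs
  have hY := hL.norm_sub_smul_le hH hs
  have hY' : ‖H₂ s - E₂ s • (1 : Op N)‖ ≤ 2 * h₂ + 2 * (ρ * h₁ ^ 2) := by
    have h2 : ‖E₂ s • (1 : Op N)‖ ≤ (h₂ + 2 * (ρ * h₁ ^ 2)) * 1 := by
      rw [norm_smul, Real.norm_eq_abs]
      exact mul_le_mul (hE₂ s hs) ContinuousLinearMap.norm_id_le
        (norm_nonneg _) ((abs_nonneg _).trans (hE₂ s hs))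
    exact (norm_sub_le_of_le (hH.norm_two_le s hs) h2).trans_eq (by ring)
  exact norm_secondCoeffDeriv_le hR hY hY' h1 (hH.norm_two_le s hs) (hH.norm_three_le s hs)
    (norm_resolventDeriv_le hP hR hY h1)
    (norm_resolventDeriv_mul_le hP hR hY h1 (hL.P_mul_R s hs))
    (norm_mul_resolventDeriv_le hP hR hY h1 (hL.R_mul_P s hs))

/-- The second-order expansion around a non-degenerate level. The approximate solution is
`e^{-iTθ - iΔ/T} (n - (i/T) R²Ḣn + T⁻² M n)`, where `M` is `secondCoeff` and the phase `Δ`, the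
second-order energy shift, absorbs the component of the residual along `n`. -/
lemma SpectralLevel.norm_second_order_le (hH : SmoothHamiltonian H H₁ H₂ H₃ h₁ h₂ h₃)
    (hL : SpectralLevel H H₁ E E₁ P R ρ) (hn : ParallelEigenvector H₁ P R n)
    (hE₁ : ∀ s ∈ Icc (0 : ℝ) 1, HasDerivWithinAt E₁ (E₂ s) (Icc 0 1) s)
    (hE₂ : ∀ s ∈ Icc (0 : ℝ) 1, |E₂ s| ≤ h₂ + 2 * (ρ * h₁ ^ 2))
    (hn1 : ∀ s ∈ Icc (0 : ℝ) 1, ‖n s‖ = 1)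
    (hP : ∀ s ∈ Icc (0 : ℝ) 1, ∀ x, P s x = (inner ℂ (n s) x : ℂ) • n s)
    (hQ : ∀ x, ‖x - P 1 x‖ ≤ ‖x‖)
    {T : ℝ} (hT : 0 < T) {U : ℝ → Op N} (hU : IsTimeEvolution H T U) {θ : ℝ → ℝ}
    (hθ : ∀ s ∈ Icc (0 : ℝ) 1, HasDerivWithinAt θ (E s) (Icc 0 1) s) (hθ0 : θ 0 = 0)
    {z : Ket N} (hz : z = n 0 - (Complex.I * (T : ℂ)⁻¹) • (R 0 * R 0 * H₁ 0) (n 0)) :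
    ‖(U 1 z - P 1 (U 1 z))
      + Complex.exp (-Complex.I * ((θ 1 * T : ℝ) : ℂ)) •
        (Complex.I * (T : ℂ)⁻¹) • (R 1 * R 1 * H₁ 1) (n 1)‖
      ≤ T⁻¹ ^ 2 * (ρ ^ 3 * h₃ + 2 * (ρ ^ 3 * h₂) + 22 * (ρ ^ 4 * h₁ * h₂) + 12 * (ρ ^ 4 * h₁ ^ 2)
          + 90 * (ρ ^ 5 * h₁ ^ 3)
          + T⁻¹ * (ρ ^ 3 * h₁ ^ 2) * (ρ ^ 3 * h₂ + 6 * (ρ ^ 4 * h₁ ^ 2))) := by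
  have m0 : (0 : ℝ) ∈ Icc (0 : ℝ) 1 := by simp
  have m1 : (1 : ℝ) ∈ Icc (0 : ℝ) 1 := by simp
  have hTc : (T : ℂ) ≠ 0 := by exact_mod_cast hT.ne'
  have hτ0 : 0 ≤ T⁻¹ := inv_nonneg.2 hT.le
  set F : ℝ → Ket N := fun s => (R s * R s * H₁ s) (n s) with hF
  set K : ℝ → Ket N := fun s =>
    firstCoeffDeriv (P s) (R s) (H₁ s - E₁ s • 1) (H₁ s) (H₂ s) (n s) with hK
  set M : ℝ → Ket N := fun s => secondCoeff (R s) (H₁ s - E₁ s • 1) (H₁ s) (H₂ s) (n s) with hM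
  set M' : ℝ → Ket N := fun s => (secondCoeffDeriv (R s)
        (-(R s * (H₁ s - E₁ s • 1) * R s) + R s * R s * H₁ s * P s + P s * H₁ s * R s * R s)
        (H₁ s - E₁ s • 1) (H₂ s - E₂ s • 1) (H₁ s) (H₂ s) (H₃ s)
        - secondCoeff (R s) (H₁ s - E₁ s • 1) (H₁ s) (H₂ s) * (R s * H₁ s)) (n s) with hM'
  -- The energy shift is minus `⟨Ḣn| R³ |Ḣn⟩`, a real number.
  set δ : ℝ → ℝ := fun s =>
    -RCLike.re (inner ℂ (H₁ s (n s)) (R s (R s (R s (H₁ s (n s))))) : ℂ) with hδ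
  have hFb : ∀ s ∈ Icc (0 : ℝ) 1, ‖F s‖ ≤ ρ ^ 2 * h₁ := fun s hs =>
    (norm_apply_le_of_le (hL.norm_first_le hH hs) (hn1 s hs).le).trans_eq (mul_one _)
  have hMb : ∀ s ∈ Icc (0 : ℝ) 1, ‖M s‖ ≤ ρ ^ 3 * h₂ + 6 * (ρ ^ 4 * h₁ ^ 2) := fun s hs =>
    (norm_apply_le_of_le (norm_secondCoeff_le (hL.norm_R_le s hs) (hL.norm_sub_smul_le hH hs)
      (hH.norm_one_le s hs) (hH.norm_two_le s hs)) (hn1 s hs).le).trans_eq (mul_one _)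
  have hM'b : ∀ s ∈ Icc (0 : ℝ) 1, ‖M' s‖
      ≤ ρ ^ 3 * h₃ + 22 * (ρ ^ 4 * h₁ * h₂) + 88 * (ρ ^ 5 * h₁ ^ 3) := fun s hs =>
    (norm_apply_le_of_le (hL.norm_second_deriv_le hH hE₂ hs) (hn1 s hs).le).trans_eq (mul_one _)
  have hδb : ∀ s ∈ Icc (0 : ℝ) 1, |δ s| ≤ ρ ^ 3 * h₁ ^ 2 := by
    intro s hs
    have hR := hL.norm_R_le s hs
    have a1 : ‖H₁ s (n s)‖ ≤ h₁ :=
      (norm_apply_le_of_le (hH.norm_one_le s hs) (hn1 s hs).le).trans_eq (mul_one _)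
    have a2 := norm_apply_le_of_le hR (norm_apply_le_of_le hR (norm_apply_le_of_le hR a1))
    rw [hδ, abs_neg]
    refine (RCLike.abs_re_le_norm _).trans ((norm_inner_le_norm _ _).trans ?_)
    refine (mul_le_mul a1 a2 (norm_nonneg _) ((norm_nonneg _).trans a1)).trans_eq ?_
    ring
  have hδc : ContinuousOn δ (Icc 0 1) := by
    have cn : ContinuousOn n (Icc 0 1) := fun s hs => (hn.hasDeriv s hs).continuousWithinAt
    have cH : ContinuousOn H₁ (Icc 0 1) := fun s hs => (hH.hasDeriv_one s hs).continuousWithinAt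
    have cR : ContinuousOn R (Icc 0 1) := fun s hs => (hL.hasDeriv_R s hs).continuousWithinAt
    have cy := cH.clm_apply cn
    exact (RCLike.continuous_re.comp_continuousOn
      (ContinuousOn.inner (𝕜 := ℂ) cy (cR.clm_apply (cR.clm_apply (cR.clm_apply cy))))).neg
  have hPK : ∀ s ∈ Icc (0 : ℝ) 1, P s (K s) = -((δ s : ℂ) • n s) := by
    intro s hs
    have r := inner_selfAdjoint (hL.isSelfAdjoint_R s hs)
    have e2 : P s (K s) = P s (H₁ s (R s (R s (R s (H₁ s (n s)))))) :=
      congrArg (fun A : Op N => A (n s))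
        (projector_mul_firstCoeffDeriv (hL.P_mul_R s hs) (hL.P_mul_P s hs))
    have him : (inner ℂ (H₁ s (n s)) (R s (R s (R s (H₁ s (n s))))) : ℂ)
        = ((RCLike.re (inner ℂ (H₁ s (n s)) (R s (R s (R s (H₁ s (n s))))) : ℂ) : ℝ) : ℂ) := by
      refine (Complex.conj_eq_iff_re.1 ?_).symm
      rw [inner_conj_symm, r, r, r]
    rw [e2, hP s hs, ← inner_selfAdjoint (hH.isSelfAdjoint_deriv s hs), him, hδ]
    push_cast
    rw [neg_smul, neg_neg]
  set Δ : ℝ → ℝ := fun s => ∫ ξ in (0 : ℝ)..s, δ ξ with hΔ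
  have hΔd : ∀ s ∈ Icc (0 : ℝ) 1, HasDerivWithinAt Δ (δ s) (Icc 0 1) s := fun s hs =>
    hasDerivWithinAt_integral_unitInterval hδc hs
  have hΔ0 : Δ 0 = 0 := by simp [hΔ]
  have hΔ1 : |Δ 1| ≤ ρ ^ 3 * h₁ ^ 2 := by
    have := norm_image_sub_le_of_norm_deriv_le_segment_01' hΔd
      (fun s hs => hδb s (Ico_subset_Icc_self hs))
    rwa [hΔ0, sub_zero] at this
  set φ : ℝ → ℂ := fun s => Complex.exp (-Complex.I * ((θ s * T + Δ s * T⁻¹ : ℝ) : ℂ)) with hφ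
  have hφn : ∀ s, ‖φ s‖ = 1 := fun s => norm_phase _
  have hφ0 : φ 0 = 1 := by simp [hφ, hθ0, hΔ0]
  have hHF : ∀ s ∈ Icc (0 : ℝ) 1, H s (F s) = (E s : ℂ) • F s + R s (H₁ s (n s)) := by
    intro s hs
    have := hL.H_R_apply hs (R s (H₁ s (n s)))
    rw [hL.P_R_apply hs, sub_zero] at this
    exact this
  have hRK : ∀ s ∈ Icc (0 : ℝ) 1, M s = R s (K s) := fun s hs =>
    congrArg (fun A : Op N => A (n s)) (mul_firstCoeffDeriv (hL.R_mul_P s hs)).symm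
  have hHM : ∀ s ∈ Icc (0 : ℝ) 1,
      H s (M s) = (E s : ℂ) • M s + K s + (δ s : ℂ) • n s := by
    intro s hs
    rw [hRK s hs, hL.H_R_apply hs, hPK s hs, sub_neg_eq_add]
  have hτ : ‖(Complex.I * (T : ℂ)⁻¹ : ℂ)‖ = T⁻¹ := by simp [abs_of_pos hT]
  have hτ2 : ‖((T : ℂ)⁻¹ ^ 2 : ℂ)‖ = T⁻¹ ^ 2 := by simp [abs_of_pos hT]
  set w : ℝ → Ket N := fun s =>
    φ s • (n s - (Complex.I * (T : ℂ)⁻¹) • F s + ((T : ℂ)⁻¹ ^ 2) • M s) with hw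
  have key := hU.norm_sub_apply_le hH.isSelfAdjoint (w := w)
    (w' := fun s => φ s • (-(R s (H₁ s (n s))) - (Complex.I * (T : ℂ)⁻¹) • K s
        + ((T : ℂ)⁻¹ ^ 2) • M' s)
      + (-(Complex.I * ((E s * T + δ s * T⁻¹ : ℝ) : ℂ)) * φ s) •
        (n s - (Complex.I * (T : ℂ)⁻¹) • F s + ((T : ℂ)⁻¹ ^ 2) • M s))
    (C := T⁻¹ ^ 2 * ((ρ ^ 3 * h₃ + 22 * (ρ ^ 4 * h₁ * h₂) + 88 * (ρ ^ 5 * h₁ ^ 3))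
        + ρ ^ 3 * h₁ ^ 2 * (ρ ^ 2 * h₁)
        + ρ ^ 3 * h₁ ^ 2 * (T⁻¹ * (ρ ^ 3 * h₂ + 6 * (ρ ^ 4 * h₁ ^ 2)))))
    (fun s hs => (((hθ s hs).mul_const T).add ((hΔd s hs).mul_const T⁻¹)).phase.smul
      (((hn.hasDeriv s hs).sub ((hL.hasDeriv_first hH hn hs).const_smul
        (Complex.I * (T : ℂ)⁻¹))).add
        ((hL.hasDeriv_second hH hn hE₁ hs).const_smul ((T : ℂ)⁻¹ ^ 2))))
    (by
      intro s hs
      have e : φ s • (-(R s (H₁ s (n s))) - (Complex.I * (T : ℂ)⁻¹) • K s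
            + ((T : ℂ)⁻¹ ^ 2) • M' s)
          + (-(Complex.I * ((E s * T + δ s * T⁻¹ : ℝ) : ℂ)) * φ s) •
            (n s - (Complex.I * (T : ℂ)⁻¹) • F s + ((T : ℂ)⁻¹ ^ 2) • M s)
          + (Complex.I * (T : ℂ)) • H s (w s)
          = φ s • ((T : ℂ)⁻¹ ^ 2) • (M' s - (δ s : ℂ) • F s
              - (δ s : ℂ) • ((Complex.I * (T : ℂ)⁻¹) • M s)) := by
        rw [hw, map_smul, map_add, map_sub, map_smul, map_smul, hHF s hs, hHM s hs,
          hL.H_apply hn hs]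
        push_cast
        match_scalars <;> field_simp <;> ring_nf <;> simp
      rw [e, norm_smul, hφn, one_mul, norm_smul, hτ2]
      refine mul_le_mul_of_nonneg_left ?_ (by positivity)
      refine norm_sub_le_of_le (norm_sub_le_of_le (hM'b s hs) ?_) ?_
      · rw [norm_smul, Complex.norm_real]
        exact mul_le_mul (hδb s hs) (hFb s hs) (norm_nonneg _) ((abs_nonneg _).trans (hδb s hs))
      · rw [norm_smul, Complex.norm_real, norm_smul, hτ]
        exact mul_le_mul (hδb s hs) (mul_le_mul_of_nonneg_left (hMb s hs) hτ0)
          (by positivity) ((abs_nonneg _).trans (hδb s hs)))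
  have hUn := norm_apply_of_star_mul_self (hU.star_mul_self hH.isSelfAdjoint m1)
  have hPF : P 1 (F 1) = 0 := hL.P_R_apply m1 _
  have hPM : P 1 (M 1) = 0 := by rw [hRK 1 m1, hL.P_R_apply m1]
  have hw0 : w 0 = z + ((T : ℂ)⁻¹ ^ 2) • M 0 := by rw [hw, hz]; simp only [hφ0, one_smul]; rfl
  have hPw : w 1 - P 1 (w 1) = φ 1 • (-((Complex.I * (T : ℂ)⁻¹) • F 1) + ((T : ℂ)⁻¹ ^ 2) • M 1) := by
    rw [hw, map_smul, map_add, map_sub, map_smul, map_smul, hPF, hPM, hn.P_apply 1 m1]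
    module
  have hφ1 : φ 1 = Complex.exp (-Complex.I * ((θ 1 * T : ℝ) : ℂ))
      * Complex.exp (-Complex.I * ((Δ 1 * T⁻¹ : ℝ) : ℂ)) := by
    rw [hφ, ← Complex.exp_add]; push_cast; ring_nf
  have e : (U 1 z - P 1 (U 1 z))
      + Complex.exp (-Complex.I * ((θ 1 * T : ℝ) : ℂ)) • (Complex.I * (T : ℂ)⁻¹) • F 1
      = -((w 1 - U 1 (w 0)) - P 1 (w 1 - U 1 (w 0)))
        - (U 1 (((T : ℂ)⁻¹ ^ 2) • M 0) - P 1 (U 1 (((T : ℂ)⁻¹ ^ 2) • M 0)))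
        - (Complex.exp (-Complex.I * ((θ 1 * T : ℝ) : ℂ))
          * (Complex.exp (-Complex.I * ((Δ 1 * T⁻¹ : ℝ) : ℂ)) - 1)) •
            (Complex.I * (T : ℂ)⁻¹) • F 1 + φ 1 • ((T : ℂ)⁻¹ ^ 2) • M 1 := by
    have : (w 1 - U 1 (w 0)) - P 1 (w 1 - U 1 (w 0))
        = (w 1 - P 1 (w 1)) - (U 1 (w 0) - P 1 (U 1 (w 0))) := by rw [map_sub]; abel
    rw [this, hPw, hw0, map_add, map_add, hφ1]
    module
  rw [e]
  have k1 := ((norm_neg _).trans_le ((hQ (w 1 - U 1 (w 0))).trans key))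
  have k2 : ‖U 1 (((T : ℂ)⁻¹ ^ 2) • M 0) - P 1 (U 1 (((T : ℂ)⁻¹ ^ 2) • M 0))‖
      ≤ T⁻¹ ^ 2 * (ρ ^ 3 * h₂ + 6 * (ρ ^ 4 * h₁ ^ 2)) := by
    refine (hQ _).trans ?_
    rw [hUn, norm_smul, hτ2]
    exact mul_le_mul_of_nonneg_left (hMb 0 m0) (by positivity)
  have k3 : ‖(Complex.exp (-Complex.I * ((θ 1 * T : ℝ) : ℂ))
          * (Complex.exp (-Complex.I * ((Δ 1 * T⁻¹ : ℝ) : ℂ)) - 1)) •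
            (Complex.I * (T : ℂ)⁻¹) • F 1‖ ≤ ρ ^ 3 * h₁ ^ 2 * T⁻¹ * (T⁻¹ * (ρ ^ 2 * h₁)) := by
    rw [norm_smul, norm_mul, norm_phase, one_mul, norm_smul, hτ]
    refine mul_le_mul ?_ (mul_le_mul_of_nonneg_left (hFb 1 m1) hτ0) (by positivity)
      (mul_nonneg ((abs_nonneg _).trans hΔ1) hτ0)
    refine (norm_phase_sub_one_le _).trans ?_
    rw [abs_mul, abs_of_nonneg hτ0]
    exact mul_le_mul_of_nonneg_right hΔ1 hτ0
  have k4 : ‖φ 1 • ((T : ℂ)⁻¹ ^ 2) • M 1‖ ≤ T⁻¹ ^ 2 * (ρ ^ 3 * h₂ + 6 * (ρ ^ 4 * h₁ ^ 2)) := by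
    rw [norm_smul, hφn, one_mul, norm_smul, hτ2]
    exact mul_le_mul_of_nonneg_left (hMb 1 m1) (by positivity)
  refine (norm_add_le_of_le (norm_sub_le_of_le (norm_sub_le_of_le k1 k2) k3) k4).trans_eq ?_
  ring

end Nondegenerate

/-! ### Operators diagonal in an orthonormal basis -/

section Diagonal

variable {N : ℕ}

/-- The operator `∑ c_ν |v_ν⟩⟨v_ν|`. The Hamiltonian, its spectral projectors and its reduced
resolvents all have this form in the eigenbasis, so their algebra is that of their real symbols. -/
noncomputable def diagOp (v : Fin N → Ket N) (c : Fin N → ℝ) : Op N :=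
  ∑ ν, (c ν : ℂ) • ketBra (v ν)

variable {v : Fin N → Ket N} {c d : Fin N → ℝ}

lemma diagOp_apply (x : Ket N) : diagOp v c x = ∑ ν, ((c ν : ℂ) * inner ℂ (v ν) x) • v ν := by
  simp [diagOp, ketBra, sum_apply, smul_smul]

lemma exists_orthonormalBasis_eq (hv : Orthonormal ℂ v) :
    ∃ b : OrthonormalBasis (Fin N) ℂ (Ket N), ∀ ν, b ν = v ν := by
  obtain ⟨b, hb⟩ := Orthonormal.exists_orthonormalBasis_extension_of_card_eq (𝕜 := ℂ)
    (E := Ket N) (ι := Fin N) (by simp) (v := v) (s := univ)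
    (hv.comp _ Subtype.val_injective)
  exact ⟨b, fun ν => hb ν (mem_univ ν)⟩

lemma Orthonormal.sum_inner_smul (hv : Orthonormal ℂ v) (x : Ket N) :
    ∑ ν, (inner ℂ (v ν) x : ℂ) • v ν = x := by
  obtain ⟨b, hb⟩ := exists_orthonormalBasis_eq hv
  simpa [hb] using b.sum_repr' x

lemma Orthonormal.sum_norm_inner_sq (hv : Orthonormal ℂ v) (x : Ket N) :
    ∑ ν, ‖(inner ℂ (v ν) x : ℂ)‖ ^ 2 = ‖x‖ ^ 2 := by
  obtain ⟨b, hb⟩ := exists_orthonormalBasis_eq hv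
  simpa [hb] using b.sum_sq_norm_inner_right x

lemma Orthonormal.norm_sum_smul_sq (hv : Orthonormal ℂ v) (S : Finset (Fin N)) (a : Fin N → ℂ) :
    ‖∑ ν ∈ S, a ν • v ν‖ ^ 2 = ∑ ν ∈ S, ‖a ν‖ ^ 2 := by
  have h := hv.inner_sum a a S
  rw [inner_self_eq_norm_sq_to_K] at h
  have h' : ((‖∑ ν ∈ S, a ν • v ν‖ ^ 2 : ℝ) : ℂ) = ((∑ ν ∈ S, ‖a ν‖ ^ 2 : ℝ) : ℂ) := by
    push_cast
    refine h.trans (Finset.sum_congr rfl fun ν _ => ?_)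
    rw [mul_comm]; simpa using Complex.mul_conj' (a ν)
  exact_mod_cast h'

lemma inner_diagOp (hv : Orthonormal ℂ v) (μ : Fin N) (x : Ket N) :
    (inner ℂ (v μ) (diagOp v c x) : ℂ) = (c μ : ℂ) * inner ℂ (v μ) x := by
  rw [diagOp_apply, hv.inner_right_fintype]

lemma Orthonormal.op_ext (hv : Orthonormal ℂ v) {A B : Op N}
    (h : ∀ x μ, (inner ℂ (v μ) (A x) : ℂ) = inner ℂ (v μ) (B x)) : A = B := by
  ext1 x
  rw [← hv.sum_inner_smul (A x), ← hv.sum_inner_smul (B x)]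
  simp [h]

lemma diagOp_mul (hv : Orthonormal ℂ v) :
    diagOp v c * diagOp v d = diagOp v (fun ν => c ν * d ν) :=
  hv.op_ext fun x μ => by
    rw [mul_apply_eq_comp, inner_diagOp hv, inner_diagOp hv, inner_diagOp hv]
    push_cast; ring

lemma diagOp_one (hv : Orthonormal ℂ v) : diagOp v (fun _ => 1) = 1 :=
  hv.op_ext fun x μ => by rw [inner_diagOp hv]; simp

lemma diagOp_zero : diagOp v (fun _ => 0) = 0 := by
  ext1 x; simp [diagOp_apply]

lemma diagOp_sub : diagOp v c - diagOp v d = diagOp v (fun ν => c ν - d ν) := by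
  ext1 x; simp [diagOp_apply, sub_mul, sub_smul, Finset.sum_sub_distrib]

lemma smul_diagOp (e : ℝ) : e • diagOp v c = diagOp v (fun ν => e * c ν) := by
  simp only [diagOp, Finset.smul_sum]
  refine Finset.sum_congr rfl fun ν _ => ?_
  rw [← Complex.coe_smul, smul_smul]
  push_cast; rfl

lemma isSelfAdjoint_diagOp : IsSelfAdjoint (diagOp v c) := by
  refine isSelfAdjoint_sum (R := Op N) _ fun ν _ => ?_
  have h : IsSelfAdjoint (ketBra (v ν)) := by
    simp [isSelfAdjoint_iff, ketBra, ContinuousLinearMap.star_eq_adjoint]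
  have hc : IsSelfAdjoint (c ν : ℂ) := Complex.conj_ofReal _
  exact hc.smul h

lemma norm_diagOp_le (hv : Orthonormal ℂ v) {C : ℝ} (hC : 0 ≤ C) (h : ∀ ν, |c ν| ≤ C) :
    ‖diagOp v c‖ ≤ C := by
  refine ContinuousLinearMap.opNorm_le_bound _ hC fun x => ?_
  rw [← abs_of_nonneg (norm_nonneg (diagOp v c x)), ← abs_of_nonneg (mul_nonneg hC (norm_nonneg x)),
    ← sq_le_sq, diagOp_apply, hv.norm_sum_smul_sq, mul_pow, ← hv.sum_norm_inner_sq x,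
    Finset.mul_sum]
  refine Finset.sum_le_sum fun ν _ => ?_
  rw [norm_mul, Complex.norm_real, Real.norm_eq_abs, mul_pow]
  gcongr
  exact h ν

lemma HasDerivWithinAt.diagOp {v : Fin N → ℝ → Ket N} {v' : Fin N → Ket N} {c : Fin N → ℝ → ℝ}
    {c' : Fin N → ℝ} {I : Set ℝ} {s : ℝ} (hv : ∀ ν, HasDerivWithinAt (v ν) (v' ν) I s)
    (hc : ∀ ν, HasDerivWithinAt (c ν) (c' ν) I s) :
    HasDerivWithinAt (fun s => diagOp (fun ν => v ν s) (fun ν => c ν s))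
      (∑ ν, ((c ν s : ℂ) • ((InnerProductSpace.rankOne ℂ (v' ν) (v ν s) : Op N)
          + InnerProductSpace.rankOne ℂ (v ν s) (v' ν)) + (c' ν : ℂ) • ketBra (v ν s))) I s :=
  HasDerivWithinAt.fun_sum fun ν _ => (hc ν).ofReal_comp.smul ((hv ν).rankOne (hv ν))

end Diagonal

/-! ### Inverse fourth powers of separated energies -/

lemma sum_inv_pow_four_Icc_le (n : ℕ) :
    ∑ k ∈ Finset.Icc 1 n, ((k : ℝ) ^ 4)⁻¹ ≤ 9 / 8 := by
  have key : ∀ n : ℕ,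
      ∑ k ∈ Finset.Icc 1 (n + 1), ((k : ℝ) ^ 4)⁻¹ ≤ 9 / 8 - 1 / (8 * (n + 1)) := by
    intro n
    induction n with
    | zero => norm_num
    | succ n ih =>
      rw [Finset.sum_Icc_succ_top (by omega)]
      have hn : (0 : ℝ) ≤ n := n.cast_nonneg
      have : (((n + 1 + 1 : ℕ) : ℝ) ^ 4)⁻¹
          ≤ 1 / (8 * ((n : ℝ) + 1)) - 1 / (8 * (((n + 1 : ℕ) : ℝ) + 1)) := by
        push_cast
        rw [div_sub_div _ _ (by positivity) (by positivity), inv_eq_one_div,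
          div_le_div_iff₀ (by positivity) (by positivity)]
        nlinarith [mul_nonneg hn hn, mul_nonneg hn (mul_nonneg hn hn),
          mul_nonneg (mul_nonneg hn hn) (mul_nonneg hn hn)]
      linarith
  rcases n with _ | n
  · norm_num
  · refine (key n).trans ?_
    have : (0 : ℝ) ≤ 1 / (8 * ((n : ℝ) + 1)) := by positivity
    linarith

/-- Numbers at distance at least `γ` from zero and from each other, on one side of zero: their
integer parts in units of `γ` are distinct positive integers. -/
lemma sum_inv_pow_four_le_of_pos {ι : Type*} (V : Finset ι) (x : ι → ℝ) {γ : ℝ} (hγ : 0 < γ)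
    (hx : ∀ i ∈ V, γ ≤ x i) (hsep : ∀ i ∈ V, ∀ j ∈ V, i ≠ j → γ ≤ |x i - x j|) :
    ∑ i ∈ V, (x i ^ 4)⁻¹ ≤ 9 / 8 * (γ ^ 4)⁻¹ := by
  set k : ι → ℕ := fun i => ⌊x i / γ⌋₊ with hk
  have hpos : ∀ i ∈ V, 1 ≤ k i := fun i hi =>
    Nat.le_floor (by rw [Nat.cast_one, le_div_iff₀ hγ, one_mul]; exact hx i hi)
  have hle : ∀ i ∈ V, (k i : ℝ) ≤ x i / γ := fun i hi =>
    Nat.floor_le (div_nonneg (hγ.le.trans (hx i hi)) hγ.le)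
  have hinj : Set.InjOn k V := by
    intro i hi j hj hij
    by_contra hne
    have h1 := hle i hi
    have h2 := hle j hj
    have h3 : x i / γ < k i + 1 := Nat.lt_floor_add_one _
    have h4 : x j / γ < k j + 1 := Nat.lt_floor_add_one _
    have h5 := hsep i hi j hj hne
    rw [hij] at h1 h3
    rw [le_div_iff₀ hγ] at h1 h2
    rw [div_lt_iff₀ hγ] at h3 h4
    have h6 : |x i - x j| < γ := by rw [abs_lt]; constructor <;> linarith
    linarith
  have h1 : ∑ i ∈ V, (x i ^ 4)⁻¹ ≤ ∑ i ∈ V, ((k i : ℝ) ^ 4)⁻¹ * (γ ^ 4)⁻¹ := by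
    refine Finset.sum_le_sum fun i hi => ?_
    have hk1 : (1 : ℝ) ≤ k i := by exact_mod_cast hpos i hi
    rw [← mul_inv, ← mul_pow]
    refine inv_anti₀ (by positivity) (pow_le_pow_left₀ (by positivity) ?_ 4)
    exact (le_div_iff₀ hγ).1 (hle i hi)
  refine h1.trans ?_
  rw [← Finset.sum_mul]
  refine mul_le_mul_of_nonneg_right ?_ (by positivity)
  rw [← Finset.sum_image (f := fun m : ℕ => ((m : ℝ) ^ 4)⁻¹) hinj]
  refine (Finset.sum_le_sum_of_subset_of_nonneg (t := Finset.Icc 1 ((V.image k).sup id)) ?_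
    fun _ _ _ => by positivity).trans (sum_inv_pow_four_Icc_le _)
  intro m hm
  rw [Finset.mem_Icc]
  refine ⟨?_, Finset.le_sup (f := id) hm⟩
  obtain ⟨i, hi, rfl⟩ := Finset.mem_image.1 hm
  exact hpos i hi

lemma sum_inv_pow_four_le (V : Finset ℝ) (x₀ : ℝ) {γ : ℝ} (hγ : 0 < γ)
    (hx : ∀ e ∈ V, γ ≤ |e - x₀|) (hsep : ∀ e ∈ V, ∀ e' ∈ V, e ≠ e' → γ ≤ |e - e'|) :
    ∑ e ∈ V, ((e - x₀) ^ 4)⁻¹ ≤ 9 / 4 * (γ ^ 4)⁻¹ := by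
  rw [← Finset.sum_filter_add_sum_filter_not V (fun e => x₀ ≤ e)]
  have h1 := sum_inv_pow_four_le_of_pos (V.filter (fun e => x₀ ≤ e)) (fun e => e - x₀) hγ
    (fun e he => by
      rw [Finset.mem_filter] at he
      simpa [abs_of_nonneg (sub_nonneg.2 he.2)] using hx e he.1)
    (fun e he e' he' hne => by
      rw [Finset.mem_filter] at he he'
      simpa using hsep e he.1 e' he'.1 hne)
  have h2 := sum_inv_pow_four_le_of_pos (V.filter (fun e => ¬ x₀ ≤ e)) (fun e => x₀ - e) hγ
    (fun e he => by
      rw [Finset.mem_filter, not_le] at he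
      have := hx e he.1
      rwa [abs_of_neg (sub_neg.2 he.2), neg_sub] at this)
    (fun e he e' he' hne => by
      rw [Finset.mem_filter] at he he'
      simpa [abs_sub_comm] using hsep e he.1 e' he'.1 hne)
  have h3 : ∀ e, ((e - x₀) ^ 4)⁻¹ = ((x₀ - e) ^ 4)⁻¹ := fun e => by
    rw [← neg_sub, Even.neg_pow (by decide)]
  simp_rw [← h3] at h2
  linarith

/-! ### The spectral levels of an instantaneous eigenbasis -/

/-- The derivative of the reduced resolvent `R` of `B`, with spectral projector `P`, from the
derivatives `P'` of `P` and `Y` of `B`: differentiate `R B = 1 - P` and `R P = 0`. -/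
lemma resolventDeriv_eq {A : Type*} [Ring A] {B P P' R D Y H₁ : A} (hBR : B * R = 1 - P)
    (hRP : R * P = 0) (hPR : P * R = 0) (hP' : P' = -(R * H₁ * P + P * H₁ * R))
    (hDB : D * B + R * Y = 0 - P') (hDP : D * P + R * P' = 0) :
    D = -(R * Y * R) + R * R * H₁ * P + P * H₁ * R * R := by
  have h1 : D = (D * B) * R + D * P := by rw [mul_assoc, hBR]; noncomm_ring
  rw [eq_sub_of_add_eq hDB, eq_neg_of_add_eq_zero_left hDP, hP'] at h1
  have r1 : ∀ x, R * (P * x) = 0 := fun x => by rw [← mul_assoc, hRP, zero_mul]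
  rw [h1]
  simp only [mul_add, add_mul, sub_mul, mul_neg, mul_assoc, hPR, r1, mul_zero, zero_sub, neg_neg,
    zero_add, add_zero]
  abel

/-- The expectation of `Ḣ` in the state `ν`, which is the derivative of its energy. -/
noncomputable def energyDeriv {N : ℕ} (H₁ : ℝ → Op N) (ket : Fin N → ℝ → Ket N) (ν : Fin N)
    (s : ℝ) : ℝ :=
  RCLike.re (inner ℂ (ket ν s) (H₁ s (ket ν s)) : ℂ)

open Classical in
/-- The projector onto the states degenerate with `μ`. As distinct levels are separated by a gap,
degeneracy can be tested at `s = 0`. -/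
noncomputable def levelProjector {N : ℕ} (ket : Fin N → ℝ → Ket N) (E : Fin N → ℝ → ℝ)
    (μ : Fin N) (s : ℝ) : Op N :=
  diagOp (fun ν => ket ν s) (fun ν => if E ν 0 = E μ 0 then 1 else 0)

open Classical in
/-- The reduced resolvent of the level of `μ`. -/
noncomputable def levelResolvent {N : ℕ} (ket : Fin N → ℝ → Ket N) (E : Fin N → ℝ → ℝ)
    (μ : Fin N) (s : ℝ) : Op N :=
  diagOp (fun ν => ket ν s) (fun ν => if E ν 0 = E μ 0 then 0 else (E ν s - E μ s)⁻¹)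

section Eigenbasis

variable {N : ℕ} {H H₁ H₂ H₃ : ℝ → Op N} {h₁ h₂ h₃ : ℝ} {ket : Fin N → ℝ → Ket N}
  {E : Fin N → ℝ → ℝ} {γ : ℝ}

lemma HasDerivWithinAt.unique_unitInterval {V : Type*} [NormedAddCommGroup V] [NormedSpace ℝ V]
    {f g : ℝ → V} {f' g' : V} {s : ℝ} (hs : s ∈ Icc (0 : ℝ) 1)
    (hf : HasDerivWithinAt f f' (Icc 0 1) s) (hg : HasDerivWithinAt g g' (Icc 0 1) s)
    (h : ∀ t ∈ Icc (0 : ℝ) 1, f t = g t) : f' = g' :=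
  (uniqueDiffOn_Icc zero_lt_one s hs).eq_deriv _ hf (hg.congr h (h s hs))

lemma HasGap.degenerate (hγ : 0 < γ) (hgap : HasGap E γ) {μ ν : Fin N} (h : E ν 0 = E μ 0)
    {s : ℝ} (hs : s ∈ Icc (0 : ℝ) 1) : E ν s = E μ s := by
  by_contra hne
  have := hgap ν μ (fun hd => hne (hd s hs)) 0 (by simp)
  rw [h, sub_self, abs_zero] at this
  exact absurd this (not_le.2 hγ)

lemma HasGap.le_abs_sub (hgap : HasGap E γ) {μ ν : Fin N} (h : E ν 0 ≠ E μ 0)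
    {s : ℝ} (hs : s ∈ Icc (0 : ℝ) 1) : γ ≤ |E ν s - E μ s| :=
  hgap ν μ (fun hd => h (hd 0 (by simp))) s hs

lemma IsInstantaneousEigenbasis.hasDeriv_ket (hket : IsInstantaneousEigenbasis H ket E)
    (ν : Fin N) {s : ℝ} (hs : s ∈ Icc (0 : ℝ) 1) :
    HasDerivWithinAt (ket ν) (ketDeriv (ket ν) s) (Icc 0 1) s :=
  (hket.differentiable ν s hs).hasDerivWithinAt

lemma IsInstantaneousEigenbasis.hamiltonian_eq (hket : IsInstantaneousEigenbasis H ket E)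
    (hH : ∀ s ∈ Icc (0 : ℝ) 1, IsSelfAdjoint (H s)) {s : ℝ} (hs : s ∈ Icc (0 : ℝ) 1) :
    H s = diagOp (fun ν => ket ν s) (fun ν => E ν s) :=
  (hket.orthonormal s hs).op_ext fun x μ => by
    rw [inner_diagOp (hket.orthonormal s hs), ← inner_selfAdjoint (hH s hs), hket.eigen s hs,
      inner_smul_left, Complex.conj_ofReal]

/-- The parallel transport condition: derivatives of degenerate states are orthogonal to all
states of the level. -/
lemma IsInstantaneousEigenbasis.inner_ketDeriv (hket : IsInstantaneousEigenbasis H ket E)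
    (hγ : 0 < γ) (hgap : HasGap E γ) {μ ν : Fin N} (h : E ν 0 = E μ 0) {s : ℝ}
    (hs : s ∈ Icc (0 : ℝ) 1) : (inner ℂ (ket μ s) (ketDeriv (ket ν) s) : ℂ) = 0 := by
  rw [← inner_conj_symm, hket.gauge ν μ (fun t ht => hgap.degenerate hγ h ht) s hs, map_zero]

/-- The Hellmann–Feynman theorem. -/
lemma IsInstantaneousEigenbasis.hasDeriv_energy (hket : IsInstantaneousEigenbasis H ket E)
    (hH : SmoothHamiltonian H H₁ H₂ H₃ h₁ h₂ h₃) (hγ : 0 < γ) (hgap : HasGap E γ) (ν : Fin N)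
    {s : ℝ} (hs : s ∈ Icc (0 : ℝ) 1) :
    HasDerivWithinAt (E ν) (energyDeriv H₁ ket ν s) (Icc 0 1) s := by
  have hk := hket.hasDeriv_ket ν hs
  have h1 := HasDerivWithinAt.inner ℂ hk ((hH.hasDeriv s hs).op_apply hk)
  have h0 := hket.inner_ketDeriv hγ hgap (rfl : E ν 0 = E ν 0) hs
  have h0' : (inner ℂ (ketDeriv (ket ν) s) (ket ν s) : ℂ) = 0 := by
    rw [← inner_conj_symm, h0, map_zero]
  rw [hket.eigen s hs, inner_add_right, ← inner_selfAdjoint (hH.isSelfAdjoint s hs),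
    hket.eigen s hs, inner_smul_left, inner_smul_right, h0, h0', mul_zero, mul_zero, add_zero,
    add_zero] at h1
  have h2 := Complex.reCLM.hasFDerivAt.comp_hasDerivWithinAt s h1
  have hE : ∀ t ∈ Icc (0 : ℝ) 1, E ν t = Complex.reCLM (inner ℂ (ket ν t) (H t (ket ν t)) : ℂ) := by
    intro t ht
    rw [hket.eigen t ht, inner_smul_right, inner_self_eq_norm_sq_to_K,
      (hket.orthonormal t ht).1 ν]
    simp
  exact h2.congr hE (hE s hs)

/-- The derivative of the eigenvalue equation. -/
lemma IsInstantaneousEigenbasis.deriv_eigen (hket : IsInstantaneousEigenbasis H ket E)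
    (hH : SmoothHamiltonian H H₁ H₂ H₃ h₁ h₂ h₃) (hγ : 0 < γ) (hgap : HasGap E γ) (ν : Fin N)
    {s : ℝ} (hs : s ∈ Icc (0 : ℝ) 1) :
    H₁ s (ket ν s) + H s (ketDeriv (ket ν) s)
      = (E ν s : ℂ) • ketDeriv (ket ν) s + (energyDeriv H₁ ket ν s : ℂ) • ket ν s := by
  have hk := hket.hasDeriv_ket ν hs
  exact HasDerivWithinAt.unique_unitInterval hs ((hH.hasDeriv s hs).op_apply hk)
    ((hket.hasDeriv_energy hH hγ hgap ν hs).ofReal_comp.smul hk)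
    (fun t ht => hket.eigen t ht ν)

lemma IsInstantaneousEigenbasis.ketDeriv_eq (hket : IsInstantaneousEigenbasis H ket E)
    (hH : SmoothHamiltonian H H₁ H₂ H₃ h₁ h₂ h₃) (hγ : 0 < γ) (hgap : HasGap E γ) {μ ν : Fin N}
    (h : E ν 0 = E μ 0) {s : ℝ} (hs : s ∈ Icc (0 : ℝ) 1) :
    ketDeriv (ket ν) s = -(levelResolvent ket E μ s (H₁ s (ket ν s))) := by
  have hv := hket.orthonormal s hs
  have hd := hket.deriv_eigen hH hγ hgap ν hs
  rw [← hv.sum_inner_smul (ketDeriv (ket ν) s), levelResolvent, diagOp_apply,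
    ← Finset.sum_neg_distrib]
  refine Finset.sum_congr rfl fun κ _ => ?_
  rw [← neg_smul]
  congr 1
  by_cases hκ : E κ 0 = E μ 0
  · rw [hket.inner_ketDeriv hγ hgap (h.trans hκ.symm) hs]
    simp [hκ]
  · have hne : ((E κ s - E μ s : ℝ) : ℂ) ≠ 0 := by
      intro h0
      have := hgap.le_abs_sub hκ hs
      rw [Complex.ofReal_eq_zero.1 h0, abs_zero] at this
      exact absurd this (not_le.2 hγ)
    have hκν : κ ≠ ν := by rintro rfl; exact hκ h
    have e := congrArg (fun x => (inner ℂ (ket κ s) x : ℂ)) hd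
    simp only [inner_add_right, inner_smul_right, hv.2 hκν, mul_zero, add_zero,
      ← inner_selfAdjoint (hH.isSelfAdjoint s hs), hket.eigen s hs, inner_smul_left,
      Complex.conj_ofReal, hgap.degenerate hγ h hs] at e
    rw [if_neg hκ]
    push_cast at hne ⊢
    field_simp
    linear_combination e

open Classical in
lemma IsInstantaneousEigenbasis.hasDeriv_levelProjector
    (hket : IsInstantaneousEigenbasis H ket E)
    (hH : SmoothHamiltonian H H₁ H₂ H₃ h₁ h₂ h₃) (hγ : 0 < γ) (hgap : HasGap E γ) (μ : Fin N)
    {s : ℝ} (hs : s ∈ Icc (0 : ℝ) 1) :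
    HasDerivWithinAt (levelProjector ket E μ)
      (-(levelResolvent ket E μ s * H₁ s * levelProjector ket E μ s
        + levelProjector ket E μ s * H₁ s * levelResolvent ket E μ s)) (Icc 0 1) s := by
  refine (HasDerivWithinAt.diagOp (c := fun ν _ => if E ν 0 = E μ 0 then (1 : ℝ) else 0)
    (fun ν => hket.hasDeriv_ket ν hs) (fun ν => hasDerivWithinAt_const _ _ _)).congr_deriv ?_
  ext1 x
  have hR : IsSelfAdjoint (levelResolvent ket E μ s) := isSelfAdjoint_diagOp
  rw [sum_apply, neg_apply, add_apply]
  simp only [add_apply, mul_apply_eq_comp, smul_apply]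
  rw [levelProjector, diagOp_apply, diagOp_apply, map_sum, map_sum, ← Finset.sum_add_distrib,
    ← Finset.sum_neg_distrib]
  refine Finset.sum_congr rfl fun ν _ => ?_
  by_cases hν : E ν 0 = E μ 0
  · simp only [hket.ketDeriv_eq hH hγ hgap hν hs, InnerProductSpace.rankOne_apply, inner_neg_left,
      inner_selfAdjoint hR, inner_selfAdjoint (hH.isSelfAdjoint_deriv s hs), map_smul, if_pos hν]
    push_cast
    module
  · simp [hν]

open Classical in
/-- The states degenerate with `μ` form a spectral level in the sense of `SpectralLevel`. -/
lemma IsInstantaneousEigenbasis.spectralLevel (hket : IsInstantaneousEigenbasis H ket E)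
    (hH : SmoothHamiltonian H H₁ H₂ H₃ h₁ h₂ h₃) (hγ : 0 < γ) (hgap : HasGap E γ) (μ : Fin N) :
    SpectralLevel H H₁ (E μ) (energyDeriv H₁ ket μ) (levelProjector ket E μ)
      (levelResolvent ket E μ) γ⁻¹ := by
  have hne : ∀ s ∈ Icc (0 : ℝ) 1, ∀ ν, E ν 0 ≠ E μ 0 → E ν s - E μ s ≠ 0 := by
    intro s hs ν hν h0
    have := hgap.le_abs_sub hν hs
    rw [h0, abs_zero] at this
    exact absurd this (not_le.2 hγ)
  have hRP : ∀ s ∈ Icc (0 : ℝ) 1, levelResolvent ket E μ s * levelProjector ket E μ s = 0 := by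
    intro s hs
    rw [levelResolvent, levelProjector, diagOp_mul (hket.orthonormal s hs), ← diagOp_zero]
    congr 1; funext ν; split_ifs <;> simp
  have hPR : ∀ s ∈ Icc (0 : ℝ) 1, levelProjector ket E μ s * levelResolvent ket E μ s = 0 := by
    intro s hs
    rw [levelResolvent, levelProjector, diagOp_mul (hket.orthonormal s hs), ← diagOp_zero]
    congr 1; funext ν; split_ifs <;> simp
  have hB : ∀ s ∈ Icc (0 : ℝ) 1, H s - E μ s • (1 : Op N)
      = diagOp (fun ν => ket ν s) (fun ν => E ν s - E μ s * 1) := by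
    intro s hs
    rw [hket.hamiltonian_eq hH.isSelfAdjoint hs, ← diagOp_one (hket.orthonormal s hs),
      smul_diagOp, diagOp_sub]
  have hRB : ∀ s ∈ Icc (0 : ℝ) 1, levelResolvent ket E μ s * (H s - E μ s • (1 : Op N))
      = 1 - levelProjector ket E μ s := by
    intro s hs
    rw [hB s hs, levelResolvent, levelProjector, diagOp_mul (hket.orthonormal s hs),
      ← diagOp_one (hket.orthonormal s hs), diagOp_sub]
    congr 1; funext ν
    by_cases hν : E ν 0 = E μ 0
    · simp [hν]
    · simp [hν, inv_mul_cancel₀ (hne s hs ν hν)]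
  have hBR : ∀ s ∈ Icc (0 : ℝ) 1, (H s - E μ s • (1 : Op N)) * levelResolvent ket E μ s
      = 1 - levelProjector ket E μ s := by
    intro s hs
    rw [← hRB s hs, hB s hs, levelResolvent, diagOp_mul (hket.orthonormal s hs),
      diagOp_mul (hket.orthonormal s hs)]
    congr 1; funext ν; ring
  refine ⟨?_, ?_, fun s _ => isSelfAdjoint_diagOp, ?_, hRP, hPR, ?_, ?_, ?_, ?_, ?_⟩
  · exact fun s hs => norm_diagOp_le (hket.orthonormal s hs) zero_le_one fun ν => by
      split_ifs <;> simp
  · refine fun s hs => norm_diagOp_le (hket.orthonormal s hs) (inv_nonneg.2 hγ.le) fun ν => ?_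
    split_ifs with hν
    · simpa using hγ.le
    · rw [abs_inv]
      exact inv_anti₀ hγ (hgap.le_abs_sub hν hs)
  · intro s hs
    rw [levelProjector, diagOp_mul (hket.orthonormal s hs)]
    congr 1; funext ν; split_ifs <;> simp
  · intro s hs
    rw [hket.hamiltonian_eq hH.isSelfAdjoint hs, levelProjector,
      diagOp_mul (hket.orthonormal s hs), smul_diagOp]
    congr 1; funext ν
    split_ifs with hν
    · rw [hgap.degenerate hγ hν hs]
    · simp
  · intro s hs
    have h := hBR s hs
    have h1 : E μ s • (1 : Op N) * levelResolvent ket E μ s = E μ s • levelResolvent ket E μ s := by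
      ext1 x; simp
    rw [sub_mul, h1] at h
    rw [eq_add_of_sub_eq h]; abel
  · intro s hs
    have hv := hket.orthonormal s hs
    refine hv.op_ext fun x κ => ?_
    simp only [mul_apply_eq_comp, smul_apply]
    rw [← Complex.coe_smul, inner_smul_right, levelProjector, inner_diagOp hv, inner_diagOp hv]
    by_cases hκ : E κ 0 = E μ 0
    · have e1 : ∀ ν, E ν 0 = E μ 0 → (inner ℂ (ket κ s) (H₁ s (ket ν s)) : ℂ)
          = energyDeriv H₁ ket μ s * inner ℂ (ket κ s) (ket ν s) := by
        intro ν hν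
        have e := congrArg (fun x => (inner ℂ (ket κ s) x : ℂ)) (hket.deriv_eigen hH hγ hgap ν hs)
        have e' : energyDeriv H₁ ket ν s = energyDeriv H₁ ket μ s :=
          HasDerivWithinAt.unique_unitInterval hs (hket.hasDeriv_energy hH hγ hgap ν hs)
            (hket.hasDeriv_energy hH hγ hgap μ hs) fun t ht => hgap.degenerate hγ hν ht
        simp only [inner_add_right, inner_smul_right,
          ← inner_selfAdjoint (hH.isSelfAdjoint s hs), hket.eigen s hs, inner_smul_left,
          hket.inner_ketDeriv hγ hgap (hν.trans hκ.symm) hs, mul_zero, add_zero, zero_add, e'] at e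
        exact e
      have e2 : (inner ℂ (ket κ s) (H₁ s (diagOp (fun ν => ket ν s)
            (fun ν => if E ν 0 = E μ 0 then 1 else 0) x)) : ℂ)
          = energyDeriv H₁ ket μ s * inner ℂ (ket κ s) (diagOp (fun ν => ket ν s)
            (fun ν => if E ν 0 = E μ 0 then 1 else 0) x) := by
        rw [diagOp_apply, map_sum, inner_sum, inner_sum, Finset.mul_sum]
        refine Finset.sum_congr rfl fun ν _ => ?_
        by_cases hν : E ν 0 = E μ 0
        · rw [map_smul, inner_smul_right, inner_smul_right, e1 ν hν]; ring
        · simp [hν]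
      rw [e2, inner_diagOp hv, if_pos hκ]
      push_cast; ring
    · simp [hκ]
  · intro s hs
    have h1 := (hket.orthonormal s hs).1 μ
    refine (RCLike.abs_re_le_norm _).trans ((norm_inner_le_norm _ _).trans ?_)
    have := (H₁ s).le_opNorm (ket μ s)
    rw [h1] at this ⊢
    linarith
  · intro s hs
    obtain ⟨D, hD⟩ : ∃ D, HasDerivWithinAt (levelResolvent ket E μ) D (Icc 0 1) s := by
      have hc : ∀ ν, ∃ c', HasDerivWithinAt
          (fun s => if E ν 0 = E μ 0 then (0 : ℝ) else (E ν s - E μ s)⁻¹) c' (Icc 0 1) s := by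
        intro ν
        by_cases hν : E ν 0 = E μ 0
        · simp only [hν, if_true]; exact ⟨0, hasDerivWithinAt_const _ _ _⟩
        · simp only [hν, if_false]
          exact ⟨_, ((hket.hasDeriv_energy hH hγ hgap ν hs).sub
            (hket.hasDeriv_energy hH hγ hgap μ hs)).inv (hne s hs ν hν)⟩
      choose c' hc' using hc
      exact ⟨_, HasDerivWithinAt.diagOp (fun ν => hket.hasDeriv_ket ν hs) hc'⟩
    have hP := hket.hasDeriv_levelProjector hH hγ hgap μ hs
    have h1 := HasDerivWithinAt.unique_unitInterval hs
      (hD.mul ((hH.hasDeriv s hs).sub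
        ((hket.hasDeriv_energy hH hγ hgap μ hs).smul_const (1 : Op N))))
      ((hasDerivWithinAt_const s (Icc 0 1) (1 : Op N)).sub hP) hRB
    have h2 := HasDerivWithinAt.unique_unitInterval hs (hD.mul hP)
      (hasDerivWithinAt_const s (Icc 0 1) (0 : Op N)) hRP
    rw [← resolventDeriv_eq (hBR s hs) (hRP s hs) (hPR s hs) rfl h1 h2]
    exact hD

open Classical in
/-- Combinations of degenerate states with constant coefficients are parallel eigenvectors. -/
lemma IsInstantaneousEigenbasis.parallelEigenvector (hket : IsInstantaneousEigenbasis H ket E)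
    (hH : SmoothHamiltonian H H₁ H₂ H₃ h₁ h₂ h₃) (hγ : 0 < γ) (hgap : HasGap E γ) (μ : Fin N)
    {S : Finset (Fin N)} (hS : ∀ ν ∈ S, E ν 0 = E μ 0) (a : Fin N → ℂ) :
    ParallelEigenvector H₁ (levelProjector ket E μ) (levelResolvent ket E μ)
      (fun s => ∑ ν ∈ S, a ν • ket ν s) where
  P_apply s hs := by
    rw [map_sum]
    refine Finset.sum_congr rfl fun ν hν => ?_
    rw [map_smul]
    congr 1
    rw [levelProjector, diagOp_apply, Finset.sum_eq_single ν]
    · simp [hS ν hν, (hket.orthonormal s hs).1 ν, inner_self_eq_norm_sq_to_K]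
    · intro κ _ hκ
      simp [(hket.orthonormal s hs).2 hκ]
    · simp
  hasDeriv s hs := by
    have h := HasDerivWithinAt.fun_sum (u := S) fun ν (_ : ν ∈ S) =>
      (hket.hasDeriv_ket ν hs).const_smul (a ν)
    refine h.congr_deriv ?_
    rw [map_sum, map_sum, ← Finset.sum_neg_distrib]
    refine Finset.sum_congr rfl fun ν hν => ?_
    rw [hket.ketDeriv_eq hH hγ hgap (hS ν hν) hs, map_smul, map_smul, smul_neg]

end Eigenbasis

/-! ### Adiabatic evolution of all levels -/

/-- The derivatives of a Hermitian, three times differentiable `H` make up a `SmoothHamiltonian`. -/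
lemma smoothHamiltonian_iteratedDerivWithin {N : ℕ} {H : ℝ → Op N}
    (hHerm : ∀ s ∈ Icc (0 : ℝ) 1, IsSelfAdjoint (H s)) (hHdiff : ThriceDifferentiable H)
    {h₁ h₂ h₃ : ℝ} (hh₁ : IsMaxNormDeriv 1 H h₁) (hh₂ : IsMaxNormDeriv 2 H h₂)
    (hh₃ : IsMaxNormDeriv 3 H h₃) :
    SmoothHamiltonian H (iteratedDerivWithin 1 H (Icc 0 1)) (iteratedDerivWithin 2 H (Icc 0 1))
      (iteratedDerivWithin 3 H (Icc 0 1)) h₁ h₂ h₃ := by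
  have hd : ∀ k < 3, ∀ s ∈ Icc (0 : ℝ) 1, HasDerivWithinAt (iteratedDerivWithin k H (Icc 0 1))
      (iteratedDerivWithin (k + 1) H (Icc 0 1) s) (Icc 0 1) s := by
    intro k hk s hs
    rw [iteratedDerivWithin_succ]
    exact (hHdiff k hk s hs).hasDerivWithinAt
  have h0 : ∀ s ∈ Icc (0 : ℝ) 1,
      HasDerivWithinAt H (iteratedDerivWithin 1 H (Icc 0 1) s) (Icc 0 1) s := by
    intro s hs
    have := hd 0 (by norm_num) s hs
    rwa [iteratedDerivWithin_zero] at this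
  exact
    { isSelfAdjoint := hHerm
      isSelfAdjoint_deriv := fun s hs =>
        HasDerivWithinAt.unique_unitInterval hs (h0 s hs).star (h0 s hs) hHerm
      hasDeriv := h0
      hasDeriv_one := hd 1 (by norm_num)
      hasDeriv_two := hd 2 (by norm_num)
      norm_one_le := fun s hs => hh₁.1 (mem_image_of_mem _ hs)
      norm_two_le := fun s hs => hh₂.1 (mem_image_of_mem _ hs)
      norm_three_le := fun s hs => hh₃.1 (mem_image_of_mem _ hs) }

section Levels

variable {N : ℕ} {H H₁ H₂ H₃ : ℝ → Op N} {h₁ h₂ h₃ : ℝ} {ket : Fin N → ℝ → Ket N}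
  {E : Fin N → ℝ → ℝ} {γ : ℝ} {G : Fin N}

lemma levelProjector_apply (hG : ∀ ν, ν ≠ G → E ν 0 ≠ E G 0) (s : ℝ) (x : Ket N) :
    levelProjector ket E G s x = (inner ℂ (ket G s) x : ℂ) • ket G s := by
  rw [levelProjector, diagOp_apply, Finset.sum_eq_single G]
  · simp
  · intro ν _ hν
    simp [hG ν hν]
  · simp

/-- The component along `ν` of `R²Ḣ G`. -/
lemma IsInstantaneousEigenbasis.inner_first (hket : IsInstantaneousEigenbasis H ket E)
    (hG : ∀ ν, ν ≠ G → E ν 0 ≠ E G 0) {s : ℝ} (hs : s ∈ Icc (0 : ℝ) 1) {ν : Fin N} (hν : ν ≠ G) :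
    (inner ℂ (ket ν s) ((levelResolvent ket E G s * levelResolvent ket E G s * H₁ s) (ket G s)) : ℂ)
      = (((E ν s - E G s) ^ 2)⁻¹ : ℝ) * inner ℂ (ket ν s) (H₁ s (ket G s)) := by
  have hv := hket.orthonormal s hs
  rw [mul_apply_eq_comp, mul_apply_eq_comp, levelResolvent, inner_diagOp hv, inner_diagOp hv,
    if_neg (hG ν hν)]
  push_cast
  rw [← inv_pow]
  ring

lemma IsInstantaneousEigenbasis.sum_inner_first (hket : IsInstantaneousEigenbasis H ket E)
    {s : ℝ} (hs : s ∈ Icc (0 : ℝ) 1) (y : Ket N) :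
    ∑ ν ∈ Finset.univ.erase G, (inner ℂ (ket ν s) (levelResolvent ket E G s y) : ℂ) • ket ν s
      = levelResolvent ket E G s y := by
  have hv := hket.orthonormal s hs
  conv_rhs => rw [← hv.sum_inner_smul (levelResolvent ket E G s y)]
  rw [Finset.sum_erase]
  rw [levelResolvent, inner_diagOp hv]
  simp

lemma continuousOn_energy (hket : IsInstantaneousEigenbasis H ket E)
    (hH : SmoothHamiltonian H H₁ H₂ H₃ h₁ h₂ h₃) (hγ : 0 < γ) (hgap : HasGap E γ) (ν : Fin N) :
    ContinuousOn (E ν) (Icc 0 1) :=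
  fun _ hs => (hket.hasDeriv_energy hH hγ hgap ν hs).continuousWithinAt

/-- The coefficients of `R²Ḣ G` at `s = 0`, grouped by levels: the sum of the norms of the groups
is bounded independently of the number of levels, because the coefficients fall off as the inverse
square of the energy difference, and the energies are separated by `γ`. -/
lemma IsInstantaneousEigenbasis.sum_sqrt_levels_le (hket : IsInstantaneousEigenbasis H ket E)
    (hH : SmoothHamiltonian H H₁ H₂ H₃ h₁ h₂ h₃) (hγ : 0 < γ) (hgap : HasGap E γ)
    (hG : ∀ ν, ν ≠ G → E ν 0 ≠ E G 0) :
    ∑ e ∈ (Finset.univ.erase G).image (fun ν => E ν 0),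
      √(∑ ν ∈ (Finset.univ.erase G).filter (fun ν => E ν 0 = e),
        ‖(inner ℂ (ket ν 0) ((levelResolvent ket E G 0 * levelResolvent ket E G 0 * H₁ 0)
          (ket G 0)) : ℂ)‖ ^ 2) ≤ 3 / 2 * (γ⁻¹ ^ 2 * h₁) := by
  have m0 : (0 : ℝ) ∈ Icc (0 : ℝ) 1 := by simp
  have hv := hket.orthonormal 0 m0
  have hh : 0 ≤ h₁ := (norm_nonneg _).trans (hH.norm_one_le 0 m0)
  set J : Finset (Fin N) := Finset.univ.erase G
  set V := J.image (fun ν => E ν 0) with hV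
  set y : Fin N → ℝ := fun ν => ‖(inner ℂ (ket ν 0) (H₁ 0 (ket G 0)) : ℂ)‖ ^ 2 with hy
  have cs := Finset.sum_sq_le_sum_mul_sum_of_sq_le_mul V
    (r := fun e => √(∑ ν ∈ J.filter (fun ν => E ν 0 = e),
        ‖(inner ℂ (ket ν 0) ((levelResolvent ket E G 0 * levelResolvent ket E G 0 * H₁ 0)
          (ket G 0)) : ℂ)‖ ^ 2))
    (f := fun e => ((e - E G 0) ^ 4)⁻¹) (g := fun e => ∑ ν ∈ J.filter (fun ν => E ν 0 = e), y ν)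
    (fun e _ => by positivity) (fun e _ => by positivity)
    (fun e _ => by
      rw [Real.sq_sqrt (by positivity), Finset.mul_sum]
      refine le_of_eq ?_
      refine Finset.sum_congr rfl fun ν hν => ?_
      obtain ⟨hν1, rfl⟩ := Finset.mem_filter.1 hν
      rw [hket.inner_first hG m0 (Finset.ne_of_mem_erase hν1), norm_mul, Complex.norm_real,
        mul_pow, Real.norm_eq_abs, sq_abs, ← inv_pow, ← pow_mul]
      simp [hy])
  have h1 : ∑ e ∈ V, ((e - E G 0) ^ 4)⁻¹ ≤ 9 / 4 * (γ ^ 4)⁻¹ := by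
    refine sum_inv_pow_four_le V _ hγ ?_ ?_
    · intro e he
      obtain ⟨ν, hν, rfl⟩ := Finset.mem_image.1 he
      exact hgap.le_abs_sub (hG ν (Finset.ne_of_mem_erase hν)) m0
    · intro e he e' he' hne
      obtain ⟨ν, hν, rfl⟩ := Finset.mem_image.1 he
      obtain ⟨κ, hκ, rfl⟩ := Finset.mem_image.1 he'
      exact hgap.le_abs_sub hne m0
  have h2 : ∑ e ∈ V, ∑ ν ∈ J.filter (fun ν => E ν 0 = e), y ν ≤ h₁ ^ 2 := by
    rw [Finset.sum_fiberwise_of_maps_to (fun ν hν => Finset.mem_image_of_mem _ hν)]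
    refine (Finset.sum_le_univ_sum_of_nonneg (fun ν => by positivity)).trans ?_
    rw [hv.sum_norm_inner_sq]
    have := norm_apply_le_of_le (hH.norm_one_le 0 m0) (hv.1 G).le
    rw [mul_one] at this
    exact pow_le_pow_left₀ (norm_nonneg _) this 2
  refine abs_le_of_sq_le_sq' (b := 3 / 2 * (γ⁻¹ ^ 2 * h₁)) (cs.trans ?_) (by positivity) |>.2
  refine (mul_le_mul h1 h2 (by positivity) (by positivity)).trans_eq ?_
  rw [← inv_pow]; ring

/-- The adiabatic theorem for the superposition `R²Ḣ G` of excited states: each level follows its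
own dynamical phase. -/
lemma IsInstantaneousEigenbasis.norm_evolution_first_sub_le
    (hket : IsInstantaneousEigenbasis H ket E)
    (hH : SmoothHamiltonian H H₁ H₂ H₃ h₁ h₂ h₃) (hγ : 0 < γ) (hgap : HasGap E γ)
    (hG : ∀ ν, ν ≠ G → E ν 0 ≠ E G 0)
    {T : ℝ} (hT : 0 < T) {U : ℝ → Op N} (hU : IsTimeEvolution H T U) :
    ‖U 1 ((levelResolvent ket E G 0 * levelResolvent ket E G 0 * H₁ 0) (ket G 0))
      - ∑ ν ∈ Finset.univ.erase G,
        (Complex.exp (-Complex.I * (((∫ ξ in (0 : ℝ)..1, E ν ξ) * T : ℝ) : ℂ))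
          * inner ℂ (ket ν 0)
            ((levelResolvent ket E G 0 * levelResolvent ket E G 0 * H₁ 0) (ket G 0))) • ket ν 1‖
      ≤ T⁻¹ * (2 * (γ⁻¹ ^ 2 * h₁) + γ⁻¹ ^ 2 * h₂ + 7 * (γ⁻¹ ^ 3 * h₁ ^ 2))
        * (3 / 2 * (γ⁻¹ ^ 2 * h₁)) := by
  have m0 : (0 : ℝ) ∈ Icc (0 : ℝ) 1 := by simp
  have hh1 : 0 ≤ h₁ := (norm_nonneg _).trans (hH.norm_one_le 0 m0)
  have hh2 : 0 ≤ h₂ := (norm_nonneg _).trans (hH.norm_two_le 0 m0)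
  have hsum := hket.sum_sqrt_levels_le hH hγ hgap hG
  set F₀ := (levelResolvent ket E G 0 * levelResolvent ket E G 0 * H₁ 0) (ket G 0) with hF₀
  set a : Fin N → ℂ := fun ν => inner ℂ (ket ν 0) F₀ with ha
  set J : Finset (Fin N) := Finset.univ.erase G
  have hexp : F₀ = ∑ ν ∈ J, a ν • ket ν 0 := (hket.sum_inner_first m0 _).symm
  have hmaps : ∀ ν ∈ J, E ν 0 ∈ J.image (fun ν => E ν 0) := fun ν hν =>
    Finset.mem_image_of_mem _ hν
  have e : U 1 F₀ - ∑ ν ∈ J, (Complex.exp (-Complex.I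
        * (((∫ ξ in (0 : ℝ)..1, E ν ξ) * T : ℝ) : ℂ)) * a ν) • ket ν 1
      = ∑ e ∈ J.image (fun ν => E ν 0), ∑ ν ∈ J.filter (fun ν => E ν 0 = e),
        (U 1 (a ν • ket ν 0) - (Complex.exp (-Complex.I
        * (((∫ ξ in (0 : ℝ)..1, E ν ξ) * T : ℝ) : ℂ)) * a ν) • ket ν 1) := by
    rw [Finset.sum_fiberwise_of_maps_to hmaps, Finset.sum_sub_distrib, ← map_sum, ← hexp]
  rw [e]
  refine (norm_sum_le_of_le (n := fun e => T⁻¹ * (2 * (γ⁻¹ ^ 2 * h₁) + γ⁻¹ ^ 2 * h₂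
      + 7 * (γ⁻¹ ^ 3 * h₁ ^ 2)) * √(∑ ν ∈ J.filter (fun ν => E ν 0 = e), ‖a ν‖ ^ 2))
      _ fun e he => ?_).trans ?_
  · obtain ⟨μ, hμ, rfl⟩ := Finset.mem_image.1 he
    have hS : ∀ ν ∈ J.filter (fun ν => E ν 0 = E μ 0), E ν 0 = E μ 0 := fun ν hν =>
      (Finset.mem_filter.1 hν).2
    have h := (hket.spectralLevel hH hγ hgap μ).norm_evolution_sub_le hH
      (hket.parallelEigenvector hH hγ hgap μ hS a) hT hU
      (θ := fun s => ∫ ξ in (0 : ℝ)..s, E μ ξ)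
      (fun s hs => hasDerivWithinAt_integral_unitInterval
        (continuousOn_energy hket hH hγ hgap μ) hs) (by simp)
      (b := √(∑ ν ∈ J.filter (fun ν => E ν 0 = E μ 0), ‖a ν‖ ^ 2))
      (fun s hs => by
        rw [← (hket.orthonormal s hs).norm_sum_smul_sq, Real.sqrt_sq (norm_nonneg _)])
    refine le_trans (le_of_eq ?_) h
    rw [Finset.sum_sub_distrib, ← map_sum, Finset.smul_sum]
    congr 2
    refine Finset.sum_congr rfl fun ν hν => ?_
    have hint : ∫ ξ in (0 : ℝ)..1, E ν ξ = ∫ ξ in (0 : ℝ)..1, E μ ξ := by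
      refine intervalIntegral.integral_congr fun ξ hξ => ?_
      rw [uIcc_of_le zero_le_one] at hξ
      exact hgap.degenerate hγ (hS ν hν) hξ
    rw [hint, smul_smul]
  · rw [← Finset.mul_sum]
    exact mul_le_mul_of_nonneg_left hsum (by positivity)

/-- The boundary term at `s` in terms of `R²Ḣ G`. -/
lemma IsInstantaneousEigenbasis.boundaryTerm_eq (hket : IsInstantaneousEigenbasis H ket E)
    (hH : SmoothHamiltonian H H₁ H₂ H₃ h₁ h₂ h₃) (hγ : 0 < γ) (hgap : HasGap E γ)
    (hG : ∀ ν, ν ≠ G → ∀ s ∈ Icc (0 : ℝ) 1, E ν s ≠ E G s)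
    {T : ℝ} (hT : 0 < T) {s : ℝ} (hs : s ∈ Icc (0 : ℝ) 1) :
    boundaryTerm ket E G T s = -(Complex.I * (T : ℂ)⁻¹) • ∑ ν ∈ Finset.univ.erase G,
        (Complex.exp (-Complex.I * (((∫ ξ in (0 : ℝ)..1, E ν ξ) * T : ℝ) : ℂ))
          * Complex.exp (-Complex.I * (((∫ ξ in (0 : ℝ)..s, gapFn E G ν ξ) * T : ℝ) : ℂ))
          * inner ℂ (ket ν s)
            ((levelResolvent ket E G s * levelResolvent ket E G s * H₁ s) (ket G s))) • ket ν 1 := by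
  have m0 : (0 : ℝ) ∈ Icc (0 : ℝ) 1 := by simp
  have hG0 : ∀ ν, ν ≠ G → E ν 0 ≠ E G 0 := fun ν hν => hG ν hν 0 m0
  have hTc : (T : ℂ) ≠ 0 := by exact_mod_cast hT.ne'
  have hv := hket.orthonormal s hs
  rw [boundaryTerm, Finset.smul_sum]
  refine Finset.sum_congr rfl fun ν hν => ?_
  have hνG := Finset.ne_of_mem_erase hν
  have hg : ((E G s - E ν s : ℝ) : ℂ) ≠ 0 := by
    rw [Ne, Complex.ofReal_eq_zero, sub_eq_zero]
    exact (hG ν hνG s hs).symm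
  have hi : (inner ℂ (ketDeriv (ket ν) s) (ket G s) : ℂ)
      = -((E G s - E ν s : ℝ) : ℂ)⁻¹ * inner ℂ (ket ν s) (H₁ s (ket G s)) := by
    have hR : IsSelfAdjoint (levelResolvent ket E ν s) := isSelfAdjoint_diagOp
    have hRG : levelResolvent ket E ν s (ket G s) = ((E G s - E ν s : ℝ) : ℂ)⁻¹ • ket G s := by
      rw [levelResolvent, diagOp_apply, Finset.sum_eq_single G]
      · simp [(hG0 ν hνG).symm, inner_self_eq_norm_sq_to_K, hv.1 G]
      · intro κ _ hκ
        simp [hv.2 hκ]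
      · simp
    rw [hket.ketDeriv_eq hH hγ hgap (rfl : E ν 0 = E ν 0) hs, inner_neg_left, inner_selfAdjoint hR,
      inner_selfAdjoint (hH.isSelfAdjoint_deriv s hs), hRG, map_smul, inner_smul_right, neg_mul]
  rw [hket.inner_first hG0 hs hνG, hi, smul_smul, gapFn]
  congr 1
  have hsq : (E ν s - E G s) ^ 2 = (E G s - E ν s) ^ 2 := by ring
  rw [hsq]
  generalize E G s - E ν s = g at hg ⊢
  push_cast
  field_simp
  simp

end Levels

/-! ### The error bound -/

/-- The part of `adiabaticR` that is free of `T` is a lower bound: the bracket, with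
`x = Γ / (γ T)`, is at least `eˣ - 1 - x`. -/
lemma adiabaticR_ge {h₁ h₂ h₃ γ T : ℝ} (hh1 : 0 ≤ h₁) (hh2 : 0 ≤ h₂) (hγ : 0 < γ) (hT : 0 < T) :
    (2 * h₂ + h₃) * γ⁻¹ ^ 3 + (25 * h₁ * h₂ + 16 * h₁ ^ 2) * γ⁻¹ ^ 4 + 118 * h₁ ^ 3 * γ⁻¹ ^ 5
      ≤ adiabaticR h₁ h₂ h₃ γ T := by
  have hΓ : 0 ≤ adiabaticGamma h₁ h₂ γ := by unfold adiabaticGamma; positivity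
  have hx : 0 ≤ adiabaticGamma h₁ h₂ γ / (γ * T) := by positivity
  have hy : 0 ≤ adiabaticGamma h₁ h₂ γ / (h₁ * T) := by positivity
  have hexp := Real.add_one_le_exp (adiabaticGamma h₁ h₂ γ / (γ * T))
  have hbr : 0 ≤ T ^ 2 * ((1 + adiabaticGamma h₁ h₂ γ / (h₁ * T))
          * (Real.exp (adiabaticGamma h₁ h₂ γ / (γ * T)) - 1)
        - adiabaticGamma h₁ h₂ γ / (γ * T)) := by
    refine mul_nonneg (by positivity) ?_
    nlinarith [mul_nonneg hy (show 0 ≤ Real.exp (adiabaticGamma h₁ h₂ γ / (γ * T)) - 1 by linarith)]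
  have h1 : 0 ≤ h₂ ^ 2 * γ⁻¹ ^ 4 := by positivity
  have h2 : 0 ≤ 12 * h₂ * h₁ ^ 2 * γ⁻¹ ^ 5 := by positivity
  have h3 : 0 ≤ 36 * h₁ ^ 4 * γ⁻¹ ^ 6 := by positivity
  unfold adiabaticR
  simp only [div_eq_mul_inv _ (γ ^ 3), div_eq_mul_inv _ (γ ^ 4), div_eq_mul_inv _ (γ ^ 5),
    div_eq_mul_inv _ (γ ^ 6), ← inv_pow]
  linarith

theorem theorem4 {N : ℕ} (H : ℝ → Op N)
    (hHerm : ∀ s ∈ Icc (0 : ℝ) 1, IsSelfAdjoint (H s))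
    (hHdiff : ThriceDifferentiable H)
    (h₁ h₂ h₃ : ℝ) (hh₁ : IsMaxNormDeriv 1 H h₁) (hh₂ : IsMaxNormDeriv 2 H h₂)
    (hh₃ : IsMaxNormDeriv 3 H h₃)
    (ket : Fin N → ℝ → Ket N) (E : Fin N → ℝ → ℝ)
    (hket : IsInstantaneousEigenbasis H ket E)
    (γ : ℝ) (hγ : 0 < γ) (hgap : HasGap E γ)
    (G : Fin N) (hG : ∀ ν, ν ≠ G → ∀ s ∈ Icc (0 : ℝ) 1, E ν s ≠ E G s)
    (T : ℝ) (hT : 0 < T) (U : ℝ → Op N) (hU : IsTimeEvolution H T U) :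
    ‖(1 - ketBra (ket G 1)) (U 1 (ket G 0))
        - (boundaryTerm ket E G T 1 - boundaryTerm ket E G T 0)‖
      ≤ adiabaticR h₁ h₂ h₃ γ T / T ^ 2 := by
  have m0 : (0 : ℝ) ∈ Icc (0 : ℝ) 1 := by simp
  have m1 : (1 : ℝ) ∈ Icc (0 : ℝ) 1 := by simp
  have hTc : (T : ℂ) ≠ 0 := by exact_mod_cast hT.ne'
  have hH := smoothHamiltonian_iteratedDerivWithin hHerm hHdiff hh₁ hh₂ hh₃
  set H₁ := iteratedDerivWithin 1 H (Icc 0 1) with hH₁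
  set H₂ := iteratedDerivWithin 2 H (Icc 0 1) with hH₂
  have p1 : 0 ≤ h₁ := (norm_nonneg _).trans (hH.norm_one_le 0 m0)
  have p2 : 0 ≤ h₂ := (norm_nonneg _).trans (hH.norm_two_le 0 m0)
  have p3 : 0 ≤ h₃ := (norm_nonneg _).trans (hH.norm_three_le 0 m0)
  have hG0 : ∀ ν, ν ≠ G → E ν 0 ≠ E G 0 := fun ν hν => hG ν hν 0 m0
  have hL := hket.spectralLevel hH hγ hgap G
  have hv1 := hket.orthonormal 1 m1
  -- The first-order coefficient `R²Ḣ G` at the two end points.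
  set F₀ := (levelResolvent ket E G 0 * levelResolvent ket E G 0 * H₁ 0) (ket G 0) with hF₀
  set F₁ := (levelResolvent ket E G 1 * levelResolvent ket E G 1 * H₁ 1) (ket G 1) with hF₁
  set φ : Fin N → ℂ := fun ν =>
    Complex.exp (-Complex.I * (((∫ ξ in (0 : ℝ)..1, E ν ξ) * T : ℝ) : ℂ)) with hφ
  have hφn : ∀ ν, ‖φ ν‖ = 1 := fun ν => norm_phase _
  set S := ∑ ν ∈ Finset.univ.erase G, (φ ν * inner ℂ (ket ν 0) F₀) • ket ν 1 with hS
  have hF₀n : ‖F₀‖ ≤ γ⁻¹ ^ 2 * h₁ :=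
    (norm_apply_le_of_le (hL.norm_first_le hH m0)
      ((hket.orthonormal 0 m0).1 G).le).trans_eq (mul_one _)
  have hF₁n : ‖F₁‖ ≤ γ⁻¹ ^ 2 * h₁ :=
    (norm_apply_le_of_le (hL.norm_first_le hH m1) (hv1.1 G).le).trans_eq (mul_one _)
  have hτ : ‖(Complex.I * (T : ℂ)⁻¹ : ℂ)‖ = T⁻¹ := by simp [abs_of_pos hT]
  have hint : ∀ ν, IntervalIntegrable (E ν) volume 0 1 := fun ν =>
    (by simpa [uIcc_of_le (zero_le_one (α := ℝ))] using continuousOn_energy hket hH hγ hgap ν :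
      ContinuousOn (E ν) (uIcc 0 1)).intervalIntegrable
  have hB0 : boundaryTerm ket E G T 0 = -(Complex.I * (T : ℂ)⁻¹) • S := by
    rw [hket.boundaryTerm_eq hH hγ hgap hG hT m0]
    simp [hS, hφ, hF₀]
  have hB1 : boundaryTerm ket E G T 1 = -(Complex.I * (T : ℂ)⁻¹) • φ G • F₁ := by
    rw [hket.boundaryTerm_eq hH hγ hgap hG hT m1]
    have : F₁ = ∑ ν ∈ Finset.univ.erase G, (inner ℂ (ket ν 1) F₁ : ℂ) • ket ν 1 :=
      (hket.sum_inner_first m1 _).symm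
    conv_rhs => rw [this]
    rw [Finset.smul_sum (r := φ G)]
    congr 1
    refine Finset.sum_congr rfl fun ν _ => ?_
    rw [smul_smul, ← Complex.exp_add]
    congr 2
    simp only [hφ, gapFn]
    rw [intervalIntegral.integral_sub (hint G) (hint ν)]
    congr 1
    push_cast
    ring
  have hP : ∀ x, ketBra (ket G 1) x = levelProjector ket E G 1 x := fun x => by
    rw [levelProjector_apply hG0]; rfl
  have hQ : ∀ x, ‖x - levelProjector ket E G 1 x‖ ≤ ‖x‖ := by
    intro x
    have h1 : x - levelProjector ket E G 1 x = diagOp (fun ν => ket ν 1)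
        (fun ν => 1 - if E ν 0 = E G 0 then 1 else 0) x := by
      rw [← diagOp_sub, diagOp_one hv1]; rfl
    rw [h1]
    refine (norm_apply_le_of_le (norm_diagOp_le hv1 zero_le_one fun ν => ?_) le_rfl).trans_eq
      (one_mul _)
    split_ifs <;> simp
  have hUn := norm_apply_of_star_mul_self (hU.star_mul_self hHerm m1)
  have hSP : levelProjector ket E G 1 S = 0 := by
    rw [levelProjector_apply hG0, hS, inner_sum, Finset.sum_eq_zero, zero_smul]
    intro ν hν
    rw [inner_smul_right, hv1.2 (Finset.ne_of_mem_erase hν).symm, mul_zero]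
  have hSn : ‖S‖ ≤ γ⁻¹ ^ 2 * h₁ := by
    refine le_trans (abs_le_of_sq_le_sq' ?_ (norm_nonneg F₀)).2 hF₀n
    rw [hS, hv1.norm_sum_smul_sq, ← (hket.orthonormal 0 m0).sum_norm_inner_sq F₀]
    refine (Finset.sum_le_univ_sum_of_nonneg fun ν => by positivity).trans_eq ?_
    simp [hφn]
  have hLHS : (1 - ketBra (ket G 1)) (U 1 (ket G 0))
        - (boundaryTerm ket E G T 1 - boundaryTerm ket E G T 0)
      = (U 1 (ket G 0) - levelProjector ket E G 1 (U 1 (ket G 0)))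
        + φ G • (Complex.I * (T : ℂ)⁻¹) • F₁ - (Complex.I * (T : ℂ)⁻¹) • S := by
    rw [hB0, hB1, ← hP, sub_apply, one_apply_eq_self]
    module
  have hτ0 : 0 < T⁻¹ := inv_pos.2 hT
  have hρ0 : 0 < γ⁻¹ := inv_pos.2 hγ
  have hR := adiabaticR_ge (h₃ := h₃) p1 p2 hγ hT
  rw [div_eq_mul_inv, ← inv_pow, hLHS]
  refine le_trans ?_ (mul_le_mul_of_nonneg_right hR (by positivity))
  rcases le_total (T⁻¹ * (γ⁻¹ ^ 2 * h₁)) 1 with hsmall | hlarge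
  · have hE₁ : ∀ s ∈ Icc (0 : ℝ) 1, HasDerivWithinAt (energyDeriv H₁ ket G)
        (RCLike.re (inner ℂ (ket G s) (H₂ s (ket G s) + H₁ s (ketDeriv (ket G) s))
          + inner ℂ (ketDeriv (ket G) s) (H₁ s (ket G s)) : ℂ)) (Icc 0 1) s := fun s hs =>
      Complex.reCLM.hasFDerivAt.comp_hasDerivWithinAt s (HasDerivWithinAt.inner ℂ
        (hket.hasDeriv_ket G hs) ((hH.hasDeriv_one s hs).op_apply (hket.hasDeriv_ket G hs)))
    have hE₂ : ∀ s ∈ Icc (0 : ℝ) 1,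
        |RCLike.re (inner ℂ (ket G s) (H₂ s (ket G s) + H₁ s (ketDeriv (ket G) s))
          + inner ℂ (ketDeriv (ket G) s) (H₁ s (ket G s)) : ℂ)| ≤ h₂ + 2 * (γ⁻¹ * h₁ ^ 2) := by
      intro s hs
      have g1 := ((hket.orthonormal s hs).1 G).le
      have a1 := norm_apply_le_of_le (hH.norm_one_le s hs) g1
      have a2 := norm_apply_le_of_le (hH.norm_two_le s hs) g1
      have a3 : ‖ketDeriv (ket G) s‖ ≤ γ⁻¹ * (h₁ * 1) := by
        rw [hket.ketDeriv_eq hH hγ hgap (rfl : E G 0 = E G 0) hs, norm_neg]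
        exact norm_apply_le_of_le (hL.norm_R_le s hs) a1
      have a4 := norm_apply_le_of_le (hH.norm_one_le s hs) a3
      refine (RCLike.abs_re_le_norm _).trans ((norm_add_le_of_le
        ((norm_inner_le_norm _ _).trans (mul_le_mul g1 (norm_add_le_of_le a2 a4) (norm_nonneg _)
          zero_le_one)) ((norm_inner_le_norm _ _).trans (mul_le_mul a3 a1 (norm_nonneg _)
          (by positivity)))).trans_eq ?_)
      ring
    have hpar : ParallelEigenvector H₁ (levelProjector ket E G) (levelResolvent ket E G)
        (ket G) := by
      simpa using hket.parallelEigenvector hH hγ hgap G (S := {G}) (by simp) (fun _ => 1)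
    have k1 := hL.norm_second_order_le hH hpar hE₁ hE₂
      (fun s hs => (hket.orthonormal s hs).1 G) (fun s _ x => levelProjector_apply hG0 s x) hQ hT hU
      (θ := fun s => ∫ ξ in (0 : ℝ)..s, E G ξ)
      (fun s hs => hasDerivWithinAt_integral_unitInterval
        (continuousOn_energy hket hH hγ hgap G) hs) (by simp) rfl
    have k2 := hket.norm_evolution_first_sub_le hH hγ hgap hG0 hT hU
    -- The evolution of `G` is split into that of the corrected state `z` and of its correction.
    set z := ket G 0 - (Complex.I * (T : ℂ)⁻¹) • F₀ with hz
    have hsplit : (U 1 (ket G 0) - levelProjector ket E G 1 (U 1 (ket G 0)))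
          + φ G • (Complex.I * (T : ℂ)⁻¹) • F₁ - (Complex.I * (T : ℂ)⁻¹) • S
        = (U 1 z - levelProjector ket E G 1 (U 1 z) + φ G • (Complex.I * (T : ℂ)⁻¹) • F₁)
          + (Complex.I * (T : ℂ)⁻¹) • ((U 1 F₀ - S) - levelProjector ket E G 1 (U 1 F₀ - S)) := by
      rw [map_sub _ (U 1 F₀), hSP, hz, map_sub, map_sub, map_smul, map_smul]
      module
    rw [hsplit]
    have k3 : ‖(Complex.I * (T : ℂ)⁻¹) • ((U 1 F₀ - S) - levelProjector ket E G 1 (U 1 F₀ - S))‖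
        ≤ T⁻¹ * (T⁻¹ * (2 * (γ⁻¹ ^ 2 * h₁) + γ⁻¹ ^ 2 * h₂ + 7 * (γ⁻¹ ^ 3 * h₁ ^ 2))
          * (3 / 2 * (γ⁻¹ ^ 2 * h₁))) := by
      rw [norm_smul, hτ]
      exact mul_le_mul_of_nonneg_left ((hQ _).trans k2) hτ0.le
    refine (norm_add_le_of_le k1 k3).trans ?_
    -- What remains compares coefficients: in units of the gap, those of `h₁ ^ 2`, `h₁ * h₂` and
    -- `h₁ ^ 3` are at most `12 + 3`, `22 + 3 / 2 + 1` and `90 + 21 / 2 + 6`, where the last summands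
    -- of the latter two come from the term of order `T⁻³` by `hsmall`.
    generalize T⁻¹ = τ at *
    generalize γ⁻¹ = ρ at *
    have e1 : 0 ≤ (1 - τ * (ρ ^ 2 * h₁)) * (ρ ^ 4 * h₁ * h₂ + 6 * (ρ ^ 5 * h₁ ^ 3)) :=
      mul_nonneg (by linarith) (by positivity)
    have e2 : 0 ≤ ρ ^ 4 * h₁ * h₂ := by positivity
    have e3 : 0 ≤ ρ ^ 5 * h₁ ^ 3 := by positivity
    have e4 : 0 ≤ ρ ^ 4 * h₁ ^ 2 := by positivity
    have e5 : 0 ≤ τ ^ 2 := by positivity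
    nlinarith [mul_nonneg e5 e1, mul_nonneg e5 e2, mul_nonneg e5 e3, mul_nonneg e5 e4]
  · -- For small `T` the norms of the three terms suffice, as `1 + 2 x ≤ 16 x ^ 2` for `1 ≤ x`.
    have k1 : ‖U 1 (ket G 0) - levelProjector ket E G 1 (U 1 (ket G 0))‖ ≤ 1 :=
      (hQ _).trans (by rw [hUn, (hket.orthonormal 0 m0).1 G])
    have k2 : ‖φ G • (Complex.I * (T : ℂ)⁻¹) • F₁‖ ≤ T⁻¹ * (γ⁻¹ ^ 2 * h₁) := by
      rw [norm_smul, hφn, one_mul, norm_smul, hτ]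
      exact mul_le_mul_of_nonneg_left hF₁n hτ0.le
    have k3 : ‖(Complex.I * (T : ℂ)⁻¹) • S‖ ≤ T⁻¹ * (γ⁻¹ ^ 2 * h₁) := by
      rw [norm_smul, hτ]
      exact mul_le_mul_of_nonneg_left hSn hτ0.le
    refine (norm_sub_le_of_le (norm_add_le_of_le k1 k2) k3).trans ?_
    have e : (16 * h₁ ^ 2) * γ⁻¹ ^ 4 * T⁻¹ ^ 2 = 16 * (T⁻¹ * (γ⁻¹ ^ 2 * h₁)) ^ 2 := by ring
    have e1 : 0 ≤ ((2 * h₂ + h₃) * γ⁻¹ ^ 3 + 25 * h₁ * h₂ * γ⁻¹ ^ 4 + 118 * h₁ ^ 3 * γ⁻¹ ^ 5)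
        * T⁻¹ ^ 2 := by positivity
    nlinarith
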